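/- **Theorem 2.4.** Let $\mathbb X\subseteq\mathbb R$ be an unbounded Borel set and let $\Xi=(\xi_n)_{n\ge 0}$ be a time-homogeneous $\mathbb X$-valued Markov chain; write $\Pr_x,\mathbb E_x$ for its law and expectation when $\xi_0=x\in\mathbb X$, put $\theta=\xi_1-\xi_0$, $\theta_+=\max(\theta,0)$, $\theta_-=\max(-\theta,0)$ and $\mu(x)=\mathbb E_x[\theta]$. Suppose that there are constants $\alpha\in(1,2)$, $\beta>\alpha$, $c>0$, $x_0\ge 0$, $\gamma\ge 0$ and $b\in\mathbb R$ such that (with $x$ ranging over $\mathbb X$, and conditions on an empty set of $x$ being void) $$\lim_{y\to\infty}\sup_{x\ge x_0}\bigl|y^\alpha\Pr_x[\theta_+>y]-c\bigr|=\lim_{y\to\infty}\sup_{x\le -x_0}\bigl|y^\alpha\Pr_x[\theta_->y]-c\bigr|=0,$$ $$\sup_{x\ge x_0}\mathbb E_x[\theta_-^\beta]<\infty,\qquad \sup_{x\le -x_0}\mathbb E_x[\theta_+^\beta]<\infty,$$ $$\lim_{x\to+\infty}x^\gamma\mu(x)=\lim_{x\to-\infty}\bigl(-|x|^\gamma\mu(x)\bigr)=b.$$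 Let $\tau_a=\min\{n\ge 0:|\xi_n|\le a\}$, with $\tau_a=\infty$ if there is no such $n$. Let $q>0$. Then for all $a$ sufficiently large and all $x\in\mathbb X$ with $|x|>a$, the following hold. (i) If $\gamma>\alpha-1$, then $\mathbb E_x[\tau_a^q]<\infty$ for $q<1/\alpha$, and $\mathbb E_x[\tau_a^q]=\infty$ for $q>1/\alpha$. (ii) If $\gamma=\alpha-1$ and $b<c\pi|\csc(\pi\alpha)|$, then $\mathbb E_x[\tau_a^q]<\infty$ for $q<\nu^\star/\alpha$, and $\mathbb E_x[\tau_a^q]=\infty$ for $q>\nu^\star/\alpha$, where $\nu^\star$ is the unique solution in $(0,\alpha)$ (which exists) of $$\frac bc=(\nu^\star-1)\,\frac{\Gamma(1-\alpha)\,\Gamma(\alpha-\nu^\star)}{\Gamma(2-\nu^\star)}.$$ (iii) If $\gamma<\alpha-1$ and $b<0$, then $\mathbb E_x[\tau_a^q]<\infty$ for $q<\frac{\alpha}{\gamma+1}$, and $\mathbb E_x[\tau_a^q]=\infty$ for $q\ge\frac{\alpha}{\gamma+1}$. -/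

import Mathlib

open MeasureTheory ProbabilityTheory Filter Topology Set
open scoped ENNReal

namespace HeavyTailedWalk

noncomputable section

/-- The law `Pr_x` on trajectories `(ξ₀, ξ₁, …)` of the time-homogeneous Markov chain on `X ⊆ ℝ`
with one-step transition kernel `P`, started from `ξ₀ = x` (Ionescu-Tulcea measure). -/
def pathLaw {X : Set ℝ} (P : Kernel X X) [IsMarkovKernel P] (x : X) : Measure (ℕ → X) :=
  Kernel.traj (X := fun _ : ℕ => X)
    (fun n : ℕ => P.comap
      (fun h : (i : Finset.Iic n) → X => h ⟨n, Finset.mem_Iic.2 le_rfl⟩)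
      (measurable_pi_apply _))
    0 (fun _ => x)

/-- The passage time `τ_a = min {n ≥ 0 : |ξ_n| ≤ a}`, equal to `∞` if there is no such `n`. -/
def passageTime {X : Set ℝ} (a : ℝ) (ξ : ℕ → X) : ℝ≥0∞ :=
  ⨅ (n : ℕ) (_ : |(ξ n : ℝ)| ≤ a), (n : ℝ≥0∞)

/-- The moment `E_x[τ_a ^ q]`, with values in `[0, ∞]`. -/
def passageMoment {X : Set ℝ} (P : Kernel X X) [IsMarkovKernel P] (a q : ℝ) (x : X) : ℝ≥0∞ :=
  ∫⁻ ξ, passageTime a ξ ^ q ∂(pathLaw P x)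

/-- The one-step mean drift `μ(x) = E_x[θ]`, where `θ = ξ₁ - ξ₀`. -/
def drift {X : Set ℝ} (P : Kernel X X) (x : X) : ℝ :=
  ∫ z : X, ((z : ℝ) - (x : ℝ)) ∂(P x)

/-- Heavier outward tails. The increment from `x` to `z` is `θ = z - x`, so
`θ₊ = max (z - x) 0` and `θ₋ = max (x - z) 0`. -/
structure OutwardTails {X : Set ℝ} (P : Kernel X X) (α β c x₀ : ℝ) : Prop where
  one_lt_alpha : 1 < α
  alpha_lt_two : α < 2
  alpha_lt_beta : α < β
  c_pos : 0 < c
  x₀_nonneg : 0 ≤ x₀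
  /-- `y ^ α * Pr_x[θ₊ > y] → c` as `y → ∞`, uniformly in `x ≥ x₀` -/
  right_outward : TendstoUniformlyOn
    (fun (y : ℝ) (x : X) => y ^ α * (P x).real {z : X | y < max ((z : ℝ) - (x : ℝ)) 0})
    (fun _ => c) atTop {x : X | x₀ ≤ (x : ℝ)}
  /-- `y ^ α * Pr_x[θ₋ > y] → c` as `y → ∞`, uniformly in `x ≤ -x₀` -/
  left_outward : TendstoUniformlyOn
    (fun (y : ℝ) (x : X) => y ^ α * (P x).real {z : X | y < max ((x : ℝ) - (z : ℝ)) 0})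
    (fun _ => c) atTop {x : X | (x : ℝ) ≤ -x₀}
  /-- `sup_{x ≥ x₀} E_x[θ₋ ^ β] < ∞` -/
  right_inward :
    (⨆ (x : X) (_ : x₀ ≤ (x : ℝ)),
      ∫⁻ z : X, ENNReal.ofReal (max ((x : ℝ) - (z : ℝ)) 0 ^ β) ∂(P x)) < ∞
  /-- `sup_{x ≤ -x₀} E_x[θ₊ ^ β] < ∞` -/
  left_inward :
    (⨆ (x : X) (_ : (x : ℝ) ≤ -x₀),
      ∫⁻ z : X, ENNReal.ofReal (max ((z : ℝ) - (x : ℝ)) 0 ^ β) ∂(P x)) < ∞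

/-- Asymptotics of the drift: `x ^ γ * μ(x) → b` as `x → +∞` in `X`, and
`-|x| ^ γ * μ(x) → b` as `x → -∞` in `X`. -/
structure DriftAsymptotics {X : Set ℝ} (P : Kernel X X) (γ b : ℝ) : Prop where
  gamma_nonneg : 0 ≤ γ
  right : Tendsto (fun x : X => (x : ℝ) ^ γ * drift P x)
    (comap (fun x : X => (x : ℝ)) atTop) (𝓝 b)
  left : Tendsto (fun x : X => -(|(x : ℝ)| ^ γ * drift P x))
    (comap (fun x : X => (x : ℝ)) atBot) (𝓝 b)

/-- The equation `b / c = (ν - 1) Γ(1 - α) Γ(α - ν) / Γ(2 - ν)` with `ν ∈ (0, α)`. -/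
def IsCriticalExponent (α b c ν : ℝ) : Prop :=
  ν ∈ Ioo 0 α ∧
    b / c = (ν - 1) * (Real.Gamma (1 - α) * Real.Gamma (α - ν) / Real.Gamma (2 - ν))

end

end HeavyTailedWalk

namespace HeavyTailedWalk

noncomputable section

/-! At distance `r` from the origin, Taylor expansion at scale `r` gives the mean increment of `|x|
^ ν`, for `0 < ν < α`, as `ν r ^ (ν - α) (c J(ν) + o(1)) + ν r ^ (ν - 1) m(r)`. Here `m` is the
drift counted positively outward and `J(ν)` is `jumpIntegral`, the contribution of the outward jumps
of order `r` (`HeavyRightTail.tendsto_rpow_increment`). Inward jumps have more than `α` moments and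
do not contribute at this order.

If `m(r) ~ b r ^ (1 - α)`, the increment is `ν r ^ (ν - α) (c J(ν) + b + o(1))`. `J` is strictly
increasing, and its evaluation by Gamma functions (`jumpIntegral_eq`) turns the equation for the
critical exponent into `c J(ν) + b = 0`. Below the critical exponent `|x| ^ ν` is a strict
supermartingale, and a Foster–Lyapunov argument gives `P(τ > n) = O(n ^ (-ν / α))`. Above it, a
truncation of `|x| ^ ν` is a submartingale up to distances of order `n ^ (1 / α)`. From that far out
the chain survives `n` steps with probability at least `1 / 2` (`exists_half_le_survival`), so `P(τ
> n)` is at least of order `n ^ (-ν / α)`. A drift smaller than `r ^ (1 - α)` is the case `b = 0`,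
whose exponent is `1` because `J(1) = 0`.

If the drift is of larger order `r ^ (-γ)` and inward, `|x| ^ ν` decreases in mean at rate `r ^ (ν -
1 - γ)` for every `ν < α`, so `P(τ > n) = O(n ^ (-ν / (γ + 1)))` for `γ + 1 < ν < α`. Conversely, a
single first jump beyond order `n ^ (1 / (γ + 1))` costs `n ^ (-α / (γ + 1))` and leaves a return
time longer than `n` with probability at least `1 / 2`.

Tails become moments through `passageMoment_lt_top` and `passageMoment_eq_top`. -/

/-- The trajectories that stay outside `[-a, a]` up to time `n`. -/
def survivalSet {X : Set ℝ} (a : ℝ) (n : ℕ) : Set (ℕ → X) := {ξ | ∀ k ≤ n, a < |(ξ k : ℝ)|}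

/-- The probability, starting from `x`, that the passage time exceeds `n`. -/
def survival {X : Set ℝ} (P : Kernel X X) [IsMarkovKernel P] (a : ℝ) (n : ℕ) (x : X) : ℝ :=
  (pathLaw P x).real (survivalSet a n)

/-! ### Survival probabilities and their link with passage-time moments -/

section Chain

variable {X : Set ℝ} (P : Kernel X X) (a : ℝ)

/-- Backward recursion for the survival probability. -/
def survivalRec : ℕ → X → ℝ≥0∞
  | 0 => fun x => {x : X | a < |(x : ℝ)|}.indicator 1 x
  | n + 1 => fun x => {x : X | a < |(x : ℝ)|}.indicator 1 x * ∫⁻ z, survivalRec n z ∂P x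

lemma measurableSet_outside : MeasurableSet {x : X | a < |(x : ℝ)|} :=
  measurableSet_lt measurable_const measurable_subtype_coe.abs

lemma measurable_survivalRec (n : ℕ) : Measurable (survivalRec P a n) := by
  induction n with
  | zero => exact measurable_one.indicator (measurableSet_outside a)
  | succ n ih =>
    exact (measurable_one.indicator (measurableSet_outside a)).mul ih.lintegral_kernel

lemma indicator_mul_survivalRec (n : ℕ) (x : X) :
    {x : X | a < |(x : ℝ)|}.indicator 1 x * survivalRec P a n x = survivalRec P a n x := by
  cases n <;> by_cases h : a < |(x : ℝ)| <;> simp [survivalRec, h]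

variable [IsMarkovKernel P]

instance isProbabilityMeasure_pathLaw (x : X) : IsProbabilityMeasure (pathLaw P x) := by
  unfold pathLaw; infer_instance

lemma measurable_pathLaw : Measurable (pathLaw P) := by
  unfold pathLaw
  exact (Kernel.measurable _).comp (measurable_pi_lambda _ fun _ => measurable_id)

lemma measurableSet_survivalSet (n : ℕ) : MeasurableSet (survivalSet (X := X) a n) := by
  have : survivalSet (X := X) a n = ⋂ k : ℕ, ⋂ _ : k ≤ n, {ξ : ℕ → X | a < |(ξ k : ℝ)|} := by
    ext; simp [survivalSet]
  rw [this]
  refine MeasurableSet.iInter fun k => MeasurableSet.iInter fun _ => ?_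
  exact measurableSet_lt measurable_const
    (measurable_subtype_coe.comp (measurable_pi_apply k)).abs

lemma antitone_survivalSet : Antitone (survivalSet (X := X) a) :=
  fun _ _ h _ hξ k hk => hξ k (hk.trans h)

lemma measurable_survival (n : ℕ) : Measurable (survival P a n) :=
  ((Measure.measurable_coe (measurableSet_survivalSet a n)).comp (measurable_pathLaw P)).ennreal_toReal

lemma survival_nonneg (n : ℕ) (x : X) : 0 ≤ survival P a n x := measureReal_nonneg

lemma survival_le_one (n : ℕ) (x : X) : survival P a n x ≤ 1 := measureReal_le_one

lemma antitone_survival (x : X) : Antitone fun n => survival P a n x :=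
  fun _ _ h => measureReal_mono (antitone_survivalSet a h)

lemma integrable_survival (n : ℕ) (x : X) : Integrable (survival P a n) (P x) :=
  Integrable.of_bound (measurable_survival P a n).aestronglyMeasurable 1
    (Eventually.of_forall fun z => by
      rw [Real.norm_of_nonneg (survival_nonneg P a n z)]; exact survival_le_one P a n z)

/-- The Markov property at time `j`: the joint law of the path up to `j` and of the next state is
the composition-product of the law of the path with the step kernel. -/
lemma lintegral_pathLaw_succ (x : X) (j : ℕ) {F : (Finset.Iic j → X) → ℝ≥0∞} (hF : Measurable F)
    {h : X → ℝ≥0∞} (hh : Measurable h) :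
    ∫⁻ ξ, F (Preorder.frestrictLe (π := fun _ => X) j ξ) * h (ξ (j + 1)) ∂pathLaw P x =
      ∫⁻ ξ, F (Preorder.frestrictLe (π := fun _ => X) j ξ) * ∫⁻ z, h z ∂P (ξ j) ∂pathLaw P x := by
  set κ : (n : ℕ) → Kernel ((i : Finset.Iic n) → X) X := fun n : ℕ => P.comap
      (fun h : (i : Finset.Iic n) → X => h ⟨n, Finset.mem_Iic.2 le_rfl⟩)
      (measurable_pi_apply _) with hκ
  have key := Kernel.partialTraj_compProd_eq_map_traj (X := fun _ : ℕ => X) (κ := κ)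
    (a := 0) (b := j) (Nat.zero_le j) (x₀ := fun _ => x)
  have hm : Measurable fun p : (Finset.Iic j → X) × X => F p.1 * h p.2 :=
    (hF.comp measurable_fst).mul (hh.comp measurable_snd)
  have h1 : ∫⁻ ξ, F (Preorder.frestrictLe (π := fun _ => X) j ξ) * h (ξ (j + 1)) ∂pathLaw P x =
      ∫⁻ p, F p.1 * h p.2 ∂((Kernel.traj (X := fun _ : ℕ => X) κ 0 (fun _ => x)).map
        (fun ξ => (Preorder.frestrictLe (π := fun _ => X) j ξ, ξ (j + 1)))) := by
    rw [lintegral_map hm (by fun_prop)]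
    rfl
  rw [h1, ← key, Measure.lintegral_compProd hm, ← Kernel.traj_map_frestrictLe_apply,
    lintegral_map (Measurable.lintegral_kernel_prod_right' hm) (by fun_prop)]
  refine lintegral_congr fun ξ => ?_
  change ∫⁻ z, F (Preorder.frestrictLe (π := fun _ => X) j ξ) * h z ∂P (ξ j) = _
  exact lintegral_const_mul _ hh

lemma pathLaw_ae_zero (x : X) : ∀ᵐ ξ ∂pathLaw P x, ξ 0 = x := by
  have h := Kernel.traj_map_frestrictLe_apply (X := fun _ : ℕ => X)
    (κ := fun n : ℕ => P.comap
      (fun h : (i : Finset.Iic n) → X => h ⟨n, Finset.mem_Iic.2 le_rfl⟩)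
      (measurable_pi_apply _)) 0 0 (fun _ => x)
  rw [Kernel.partialTraj_self, Kernel.id_apply] at h
  have h2 : ∀ᵐ y ∂((pathLaw P x).map (Preorder.frestrictLe (π := fun _ : ℕ => X) 0)),
      y ⟨0, Finset.mem_Iic.2 le_rfl⟩ = x := by
    unfold pathLaw
    rw [h]
    rw [ae_dirac_iff]
    exact measurableSet_eq_fun (measurable_pi_apply _) measurable_const
  exact ae_of_ae_map (by fun_prop) h2

lemma indicator_survivalSet_succ (j : ℕ) (ξ : ℕ → X) :
    (survivalSet a (j + 1)).indicator (1 : (ℕ → X) → ℝ≥0∞) ξ =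
      (survivalSet a j).indicator 1 ξ * {x : X | a < |(x : ℝ)|}.indicator 1 (ξ (j + 1)) := by
  by_cases h1 : ξ ∈ survivalSet a j <;> by_cases h2 : a < |(ξ (j + 1) : ℝ)|
  · have : ξ ∈ survivalSet a (j + 1) := fun k hk => by
      rcases Nat.le_succ_iff.1 hk with h | h
      · exact h1 k h
      · exact h ▸ h2
    simp [h1, h2, this]
  · have : ξ ∉ survivalSet a (j + 1) := fun h => h2 (h _ le_rfl)
    simp [h2, this]
  · have : ξ ∉ survivalSet a (j + 1) := fun h => h1 (antitone_survivalSet a (Nat.le_succ j) h)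
    simp [h1, this]
  · have : ξ ∉ survivalSet a (j + 1) := fun h => h2 (h _ le_rfl)
    simp [h2, this]

/-- The Markov property trades one step of the path for one step of the recursion. The indicator at
the last time is absorbed because `survivalRec` already vanishes on `[-a, a]`. -/
lemma lintegral_survivalSet_mul (x : X) (m j : ℕ) :
    ∫⁻ ξ, (survivalSet a j).indicator 1 ξ * survivalRec P a m (ξ j) ∂pathLaw P x =
      survivalRec P a (m + j) x := by
  induction j generalizing m with
  | zero =>
    have : ∀ᵐ ξ ∂pathLaw P x, (survivalSet a 0).indicator 1 ξ * survivalRec P a m (ξ 0) =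
        survivalRec P a m x := by
      filter_upwards [pathLaw_ae_zero P x] with ξ hξ
      have h0 : (survivalSet a 0).indicator (1 : (ℕ → X) → ℝ≥0∞) ξ =
          {x : X | a < |(x : ℝ)|}.indicator 1 (ξ 0) := by
        have : ξ ∈ survivalSet a 0 ↔ ξ 0 ∈ {x : X | a < |(x : ℝ)|} := by simp [survivalSet]
        by_cases h : ξ ∈ survivalSet a 0
        · simp only [indicator_of_mem h, indicator_of_mem (this.1 h), Pi.one_apply]
        · simp only [indicator_of_notMem h, indicator_of_notMem (fun h' => h (this.2 h'))]
      rw [h0, indicator_mul_survivalRec, hξ]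
    rw [lintegral_congr_ae this]
    simp
  | succ j ih =>
    have hF : Measurable ({y : Finset.Iic j → X | ∀ k : Finset.Iic j, a < |(y k : ℝ)|}.indicator
        (1 : (Finset.Iic j → X) → ℝ≥0∞)) := by
      refine measurable_one.indicator ?_
      rw [ofPred_forall]
      exact MeasurableSet.iInter fun k => measurableSet_lt measurable_const
        (measurable_subtype_coe.comp (measurable_pi_apply k)).abs
    have hFe : ∀ ξ : ℕ → X, (survivalSet a j).indicator (1 : (ℕ → X) → ℝ≥0∞) ξ =
        {y : Finset.Iic j → X | ∀ k : Finset.Iic j, a < |(y k : ℝ)|}.indicator 1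
          (Preorder.frestrictLe (π := fun _ => X) j ξ) := by
      intro ξ
      have : ξ ∈ survivalSet a j ↔ Preorder.frestrictLe (π := fun _ => X) j ξ ∈
          {y : Finset.Iic j → X | ∀ k : Finset.Iic j, a < |(y k : ℝ)|} := by
        simp [survivalSet]
      by_cases h : ξ ∈ survivalSet a j
      · simp only [indicator_of_mem h, indicator_of_mem (this.1 h), Pi.one_apply]
      · simp only [indicator_of_notMem h, indicator_of_notMem (fun h' => h (this.2 h'))]
    have h1 : ∀ ξ : ℕ → X, (survivalSet a (j + 1)).indicator 1 ξ * survivalRec P a m (ξ (j + 1)) =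
        (survivalSet a j).indicator 1 ξ * survivalRec P a m (ξ (j + 1)) := by
      intro ξ
      rw [indicator_survivalSet_succ, mul_assoc, indicator_mul_survivalRec]
    have h2 : ∀ ξ : ℕ → X, (survivalSet a j).indicator 1 ξ * survivalRec P a (m + 1) (ξ j) =
        (survivalSet a j).indicator 1 ξ * ∫⁻ z, survivalRec P a m z ∂P (ξ j) := by
      intro ξ
      by_cases h : ξ ∈ survivalSet a j
      · have : a < |(ξ j : ℝ)| := h j le_rfl
        simp [survivalRec, this]
      · simp [h]
    have h3 := lintegral_pathLaw_succ P x j hF (measurable_survivalRec P a m)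
    simp_rw [← hFe] at h3
    rw [lintegral_congr h1, h3, ← lintegral_congr h2, ih]
    congr 1
    omega

lemma pathLaw_survivalSet (n : ℕ) (x : X) :
    pathLaw P x (survivalSet a n) = survivalRec P a n x := by
  have h := lintegral_survivalSet_mul P a x 0 n
  rw [zero_add] at h
  rw [← h, ← lintegral_indicator_one (measurableSet_survivalSet a n)]
  refine lintegral_congr fun ξ => ?_
  by_cases h : ξ ∈ survivalSet a n
  · have : a < |(ξ n : ℝ)| := h n le_rfl
    simp [survivalRec, this]
  · simp [h]

variable {a}

lemma survival_zero {x : X} (hx : a < |(x : ℝ)|) : survival P a 0 x = 1 := by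
  simp [survival, measureReal_def, pathLaw_survivalSet, survivalRec, hx]

lemma survival_of_le (n : ℕ) {x : X} (hx : |(x : ℝ)| ≤ a) : survival P a n x = 0 := by
  rw [survival, measureReal_def, pathLaw_survivalSet]
  cases n <;> simp [survivalRec, hx]

/-- First-step analysis; the comparison arguments of the next section are inductions on time through
this identity. -/
lemma survival_succ (n : ℕ) {x : X} (hx : a < |(x : ℝ)|) :
    survival P a (n + 1) x = ∫ z, survival P a n z ∂P x := by
  have h : ∀ z, survival P a n z = (survivalRec P a n z).toReal := fun z => by
    rw [survival, measureReal_def, pathLaw_survivalSet]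
  simp_rw [h]
  rw [integral_toReal (measurable_survivalRec P a n).aemeasurable
    (Eventually.of_forall fun z => by rw [← pathLaw_survivalSet]; exact measure_lt_top _ _)]
  simp [survival, measureReal_def, pathLaw_survivalSet, survivalRec, hx]

lemma natCast_add_one_le_passageTime {n : ℕ} {ξ : ℕ → X} (h : ξ ∈ survivalSet a n) :
    ((n + 1 : ℕ) : ℝ≥0∞) ≤ passageTime a ξ := by
  refine le_iInf₂ fun k hk => ?_
  have : n < k := by
    by_contra hkn
    exact absurd (h k (not_lt.1 hkn)) (not_lt.2 hk)
  exact_mod_cast this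

lemma passageTime_le_natCast {n : ℕ} {ξ : ℕ → X} (h : ξ ∉ survivalSet a n) :
    passageTime a ξ ≤ n := by
  simp only [survivalSet, mem_ofPred_eq, not_forall, not_lt] at h
  obtain ⟨k, hk, hξ⟩ := h
  exact (iInf₂_le k hξ).trans (by exact_mod_cast hk)

/-- Dyadic decomposition: look at the least `k` for which survival up to `2 ^ k` fails. If there is
none, the series diverges. -/
lemma passageTime_rpow_le_tsum {q : ℝ} (hq : 0 < q) (ξ : ℕ → X) :
    passageTime a ξ ^ q ≤ 1 + ∑' k : ℕ, (survivalSet a (2 ^ k)).indicator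
      (fun _ => ((2 : ℝ≥0∞) ^ (k + 1)) ^ q) ξ := by
  classical
  by_cases hall : ∀ k : ℕ, ξ ∈ survivalSet a (2 ^ k)
  · have : ∑' k : ℕ, (survivalSet a (2 ^ k)).indicator
      (fun _ => ((2 : ℝ≥0∞) ^ (k + 1)) ^ q) ξ = ∞ := by
      rw [← top_le_iff]
      calc (∞ : ℝ≥0∞) = ∑' _ : ℕ, (1 : ℝ≥0∞) := (ENNReal.tsum_const_eq_top_of_ne_zero one_ne_zero).symm
        _ ≤ _ := ENNReal.tsum_le_tsum fun k => by
          rw [indicator_of_mem (hall k)]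
          exact ENNReal.one_le_rpow (one_le_pow₀ (by norm_num)) hq
    rw [this]; simp
  · push Not at hall
    have hk := Nat.find_spec hall
    have hmin := fun {m : ℕ} => Nat.find_min hall (m := m)
    set k := Nat.find hall
    have h1 : passageTime a ξ ^ q ≤ ((2 : ℝ≥0∞) ^ k) ^ q := by
      refine ENNReal.rpow_le_rpow ?_ hq.le
      simpa using passageTime_le_natCast hk
    -- The summand `1` pays for `k = 0`; otherwise survival up to `2 ^ (k - 1)` makes the term of
    -- index `k - 1` equal to the required bound.
    rcases Nat.eq_zero_or_pos k with h0 | h0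
    · rw [h0] at h1
      exact (h1.trans (by simp)).trans le_self_add
    · obtain ⟨m, hm⟩ := Nat.exists_eq_succ_of_ne_zero h0.ne'
      have hmem : ξ ∈ survivalSet a (2 ^ m) := by
        have := hmin (m := m) (by omega)
        simpa using this
      refine h1.trans (le_trans ?_ le_add_self)
      refine le_trans ?_ (ENNReal.le_tsum m)
      rw [indicator_of_mem hmem, hm]

lemma passageMoment_lt_top {p q C : ℝ} (hq : 0 < q) (hqp : q < p) {x : X}
    (h : ∀ n : ℕ, 1 ≤ n → survival P a n x ≤ C * (n : ℝ) ^ (-p)) :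
    passageMoment P a q x < ∞ := by
  unfold passageMoment
  have hC : 0 ≤ C := by
    have := h 1 le_rfl
    simp only [Nat.cast_one, Real.one_rpow, mul_one] at this
    exact (survival_nonneg P a 1 x).trans this
  have hterm : ∀ k : ℕ, pathLaw P x (survivalSet a (2 ^ k)) * ((2 : ℝ≥0∞) ^ (k + 1)) ^ q ≤
      ENNReal.ofReal (C * 2 ^ q * ((2 : ℝ) ^ (q - p)) ^ k) := by
    intro k
    have h2 : ((2 : ℝ≥0∞) ^ (k + 1)) ^ q = ENNReal.ofReal (((2 : ℝ) ^ (k + 1)) ^ q) := by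
      rw [← ENNReal.ofReal_rpow_of_pos (by positivity), ENNReal.ofReal_pow (by norm_num)]
      simp
    rw [h2, ← ofReal_measureReal, ← ENNReal.ofReal_mul measureReal_nonneg]
    refine ENNReal.ofReal_le_ofReal ?_
    have h3 := h (2 ^ k) Nat.one_le_two_pow
    push_cast at h3
    calc survival P a (2 ^ k) x * ((2 : ℝ) ^ (k + 1)) ^ q
        ≤ C * ((2 : ℝ) ^ k) ^ (-p) * ((2 : ℝ) ^ (k + 1)) ^ q := by gcongr
      _ = C * 2 ^ q * ((2 : ℝ) ^ (q - p)) ^ k := by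
        rw [pow_succ, Real.mul_rpow (by positivity) (by norm_num), Real.rpow_sub (by norm_num),
          div_pow, Real.rpow_neg (by positivity), ← Real.rpow_natCast_mul (by norm_num),
          ← Real.rpow_natCast_mul (by norm_num), ← Real.rpow_mul_natCast (by norm_num),
          ← Real.rpow_mul_natCast (by norm_num), mul_comm q, mul_comm p]
        field_simp
  have hsum : Summable fun k : ℕ => C * 2 ^ q * ((2 : ℝ) ^ (q - p)) ^ k := by
    refine (summable_geometric_of_lt_one (by positivity) ?_).mul_left _
    exact Real.rpow_lt_one_of_one_lt_of_neg (by norm_num) (by linarith)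
  have hm : ∀ k : ℕ, Measurable ((survivalSet (X := X) a (2 ^ k)).indicator
      (fun _ => ((2 : ℝ≥0∞) ^ (k + 1)) ^ q)) :=
    fun k => measurable_const.indicator (measurableSet_survivalSet a _)
  calc ∫⁻ ξ, passageTime a ξ ^ q ∂pathLaw P x
      ≤ ∫⁻ ξ, (1 + ∑' k : ℕ, (survivalSet a (2 ^ k)).indicator
          (fun _ => ((2 : ℝ≥0∞) ^ (k + 1)) ^ q) ξ) ∂pathLaw P x :=
        lintegral_mono fun ξ => passageTime_rpow_le_tsum hq ξ
    _ = 1 + ∑' k : ℕ, pathLaw P x (survivalSet a (2 ^ k)) * ((2 : ℝ≥0∞) ^ (k + 1)) ^ q := by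
        rw [lintegral_add_left measurable_const, lintegral_tsum fun k => (hm k).aemeasurable]
        simp only [lintegral_const, measure_univ, mul_one]
        congr 2
        ext k
        rw [lintegral_indicator_const (measurableSet_survivalSet a _), mul_comm]
    _ ≤ 1 + ∑' k : ℕ, ENNReal.ofReal (C * 2 ^ q * ((2 : ℝ) ^ (q - p)) ^ k) := by
        gcongr with k
        exact hterm k
    _ < ∞ := by
        rw [← ENNReal.ofReal_tsum_of_nonneg (fun k => by positivity) hsum]
        exact ENNReal.add_lt_top.2 ⟨ENNReal.one_lt_top, ENNReal.ofReal_lt_top⟩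

/-- A finite moment would force `n ^ q P(τ > n) ≤ E[τ ^ q; τ > n] → 0` by absolute continuity of the
integral. The tail bound is allowed at the exponent `q` itself, which is what settles the endpoint
`q = α / (γ + 1)`. -/
lemma passageMoment_eq_top {q c : ℝ} (hq : 0 < q) (hc : 0 < c) {x : X}
    (h : ∀ᶠ n : ℕ in atTop, c * (n : ℝ) ^ (-q) ≤ survival P a n x) :
    passageMoment P a q x = ∞ := by
  by_contra hne
  unfold passageMoment at hne
  have hmeas : Measurable fun ξ : ℕ → X => passageTime a ξ ^ q := by
    refine Measurable.pow_const (Measurable.iInf fun n => ?_) q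
    have : (fun ξ : ℕ → X => ⨅ (_ : |(ξ n : ℝ)| ≤ a), (n : ℝ≥0∞)) = fun ξ =>
        {ξ : ℕ → X | |(ξ n : ℝ)| ≤ a}.piecewise (fun _ => (n : ℝ≥0∞)) (fun _ => ∞) ξ := by
      ext ξ
      by_cases hξ : |(ξ n : ℝ)| ≤ a <;> simp [Set.piecewise, hξ]
    rw [this]
    exact Measurable.piecewise (measurableSet_le
      (measurable_subtype_coe.comp (measurable_pi_apply n)).abs measurable_const)
      measurable_const measurable_const
  have hfin := ae_lt_top hmeas hne
  have hnull : pathLaw P x (⋂ n, survivalSet a n) = 0 := by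
    refine measure_mono_null ?_ hfin
    intro ξ hξ
    have : passageTime a ξ = ∞ := by
      refine iInf₂_eq_top.2 fun n hn => ?_
      exact absurd ((mem_iInter.1 hξ n) n le_rfl) (not_lt.2 hn)
    simp [this, ENNReal.top_rpow_of_pos hq]
  have hlim : Tendsto (fun n => pathLaw P x (survivalSet a n)) atTop (𝓝 0) := by
    rw [← hnull]
    exact tendsto_measure_iInter_atTop
      (fun n => (measurableSet_survivalSet a n).nullMeasurableSet) (antitone_survivalSet a)
      ⟨0, measure_ne_top _ _⟩
  have hlim2 := tendsto_setLIntegral_zero hne hlim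
  have hlow : ∀ᶠ n : ℕ in atTop, ENNReal.ofReal c ≤
      ∫⁻ ξ in survivalSet a n, passageTime a ξ ^ q ∂pathLaw P x := by
    filter_upwards [h, eventually_ge_atTop 1] with n hn hn1
    have hn0 : (0 : ℝ) < n := by exact_mod_cast hn1
    calc ENNReal.ofReal c ≤ ENNReal.ofReal ((n : ℝ) ^ q * survival P a n x) := by
          refine ENNReal.ofReal_le_ofReal ?_
          calc c = (n : ℝ) ^ q * (c * (n : ℝ) ^ (-q)) := by
                rw [Real.rpow_neg hn0.le]; field_simp
            _ ≤ _ := by gcongr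
      _ = (n : ℝ≥0∞) ^ q * pathLaw P x (survivalSet a n) := by
          rw [ENNReal.ofReal_mul (by positivity), survival, ofReal_measureReal,
            ← ENNReal.ofReal_rpow_of_pos hn0, ENNReal.ofReal_natCast]
      _ = ∫⁻ _ in survivalSet a n, (n : ℝ≥0∞) ^ q ∂pathLaw P x := by
          rw [setLIntegral_const]
      _ ≤ _ := by
          refine setLIntegral_mono hmeas fun ξ hξ => ENNReal.rpow_le_rpow ?_ hq.le
          refine le_trans ?_ (natCast_add_one_le_passageTime hξ)
          exact_mod_cast Nat.le_succ n
  have := ge_of_tendsto hlim2 hlow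
  simp only [nonpos_iff_eq_zero, ENNReal.ofReal_eq_zero] at this
  linarith

end Chain

/-! ### Comparison principles for survival probabilities -/

section Lyapunov

variable {X : Set ℝ} {P : Kernel X X} [IsMarkovKernel P] {a : ℝ}

/-- Polynomial survival bound of order less than one from a Foster–Lyapunov inequality. -/
lemma survival_le_of_drift_of_lt_one {f : X → ℝ} (hf : ∀ z, 0 ≤ f z)
    (hpos : ∀ x : X, a < |(x : ℝ)| → 0 < f x)
    (hint : ∀ x : X, a < |(x : ℝ)| → Integrable f (P x)) {ε p : ℝ} (hε : 0 < ε) (hp : 0 < p)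
    (hp1 : p < 1)
    (hdrift : ∀ x : X, a < |(x : ℝ)| → ∫ z, f z ∂P x ≤ f x - ε * f x ^ (1 - 1 / p))
    {n : ℕ} (hn : 1 ≤ n) (x : X) :
    survival P a n x ≤ ε ^ (-p) * f x * (n : ℝ) ^ (-p) := by
  have hn0 : (0 : ℝ) < n := by exact_mod_cast hn
  -- `Λ` solves `Λ ε (n / Λ) ^ (1 - 1 / p) = 1`. The exponent is negative, so `Λ f` loses at least
  -- `1` in mean wherever `f ≤ n / Λ`.
  set Λ : ℝ := ε ^ (-p) * (n : ℝ) ^ (1 - p) with hΛ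
  have hΛ0 : 0 < Λ := by positivity
  have hsmall : ∀ x : X, a < |(x : ℝ)| → f x ≤ n / Λ → 1 ≤ Λ * (ε * f x ^ (1 - 1 / p)) := by
    intro x hx hfx
    have h1 : (n / Λ) ^ (1 - 1 / p) ≤ f x ^ (1 - 1 / p) := by
      refine Real.rpow_le_rpow_of_nonpos (hpos x hx) hfx ?_
      rw [sub_nonpos, le_div_iff₀ hp]; linarith
    have h2 : (n : ℝ) / Λ = (n * ε) ^ p := by
      rw [hΛ, Real.mul_rpow hn0.le hε.le, Real.rpow_neg hε.le, Real.rpow_sub hn0, Real.rpow_one]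
      field_simp
    have h3 : Λ * (ε * (n / Λ) ^ (1 - 1 / p)) = 1 := by
      rw [h2, ← Real.rpow_mul (by positivity),
        show p * (1 - 1 / p) = p - 1 by field_simp, Real.mul_rpow hn0.le hε.le, hΛ,
        Real.rpow_sub hn0, Real.rpow_sub hn0, Real.rpow_sub hε, Real.rpow_neg hε.le, Real.rpow_one,
        Real.rpow_one]
      field_simp
    calc (1 : ℝ) = Λ * (ε * (n / Λ) ^ (1 - 1 / p)) := h3.symm
      _ ≤ _ := by gcongr
  -- Where `f ≤ n / Λ`, the mean loss of `1` pays for raising the factor `k` to `k + 1`. Where `f >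
  -- n / Λ`, already `Λ f > n ≥ k`.
  have key : ∀ k : ℕ, k ≤ n → ∀ x, k * survival P a k x ≤ Λ * f x := by
    intro k
    induction k with
    | zero => intro _ x; simpa using mul_nonneg hΛ0.le (hf x)
    | succ k ih =>
      intro hk x
      rcases le_or_gt |(x : ℝ)| a with hx | hx
      · rw [survival_of_le P _ hx]; simpa using mul_nonneg hΛ0.le (hf x)
      rcases le_or_gt (f x) (n / Λ) with hfx | hfx
      · have h1 := hsmall x hx hfx
        have h2 : (k : ℝ) * survival P a (k + 1) x ≤ Λ * ∫ z, f z ∂P x := by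
          rw [survival_succ P k hx, ← integral_const_mul, ← integral_const_mul]
          exact integral_mono ((integrable_survival P a k x).const_mul _)
            ((hint x hx).const_mul _) fun z => ih (by omega) z
        have h3 := mul_le_mul_of_nonneg_left (hdrift x hx) hΛ0.le
        have h4 := survival_le_one P a (k + 1) x
        push_cast
        linarith
      · have h1 : (n : ℝ) ≤ Λ * f x := by
          rw [div_lt_iff₀ hΛ0] at hfx; linarith
        have h2 : ((k + 1 : ℕ) : ℝ) ≤ n := by exact_mod_cast hk
        have h3 := survival_le_one P a (k + 1) x
        have h4 := survival_nonneg P a (k + 1) x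
        have h5 : (0 : ℝ) ≤ (k + 1 : ℕ) := Nat.cast_nonneg _
        nlinarith
  have := key n le_rfl x
  have h2 : Λ * f x = n * (ε ^ (-p) * f x * (n : ℝ) ^ (-p)) := by
    rw [hΛ, Real.rpow_sub hn0, Real.rpow_neg hn0.le, Real.rpow_one]; ring
  rw [h2] at this
  exact le_of_mul_le_mul_left this hn0

/-- For `p > 1` the function `y ↦ (C y ^ (1 / p) + S) ^ p` is concave, hence lies below its
tangents. This lets the mean increment of `f` be inserted into a nonlinear function of `f`. -/
lemma rpow_tangent_le {p C S y y' : ℝ} (hp : 1 < p) (hC : 0 < C) (hS : 0 ≤ S) (hy : 0 < y)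
    (hy' : 0 ≤ y') :
    (C * y' ^ (1 / p) + S) ^ p ≤ (C * y ^ (1 / p) + S) ^ p +
      (C * y ^ (1 / p) + S) ^ (p - 1) * (C * y ^ (1 / p - 1) * (y' - y)) := by
  have hyp : 0 < y ^ (1 / p) := Real.rpow_pos_of_pos hy _
  set A := C * y ^ (1 / p) + S with hA
  have hA0 : 0 < A := by positivity
  have hw : C * y ^ (1 / p) / A + S / A = 1 := by rw [← add_div, ← hA, div_self hA0.ne']
  have hz : (y' / y) ^ (1 / p) ∈ Ici (0 : ℝ) := mem_Ici.2 (by positivity)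
  -- Concavity in `y'` is convexity of `t ↦ t ^ p` at `(y' / y) ^ (1 / p)` and `1`, weighted by the
  -- shares of the two summands in `A`.
  have h1 := (convexOn_rpow hp.le).2 hz (mem_Ici.2 zero_le_one)
    (show 0 ≤ C * y ^ (1 / p) / A by positivity) (show 0 ≤ S / A by positivity) hw
  simp only [smul_eq_mul] at h1
  rw [Real.one_rpow, ← Real.rpow_mul (by positivity), one_div_mul_cancel (by linarith),
    Real.rpow_one] at h1
  have h2 : C * y' ^ (1 / p) + S =
      A * (C * y ^ (1 / p) / A * (y' / y) ^ (1 / p) + S / A * 1) := by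
    rw [Real.div_rpow hy' hy.le]
    field_simp
  rw [h2, Real.mul_rpow hA0.le (by positivity)]
  refine (mul_le_mul_of_nonneg_left h1 (by positivity)).trans (le_of_eq ?_)
  rw [Real.rpow_sub hA0, Real.rpow_sub hy, Real.rpow_one, Real.rpow_one]
  have h3 : S = A - C * y ^ (1 / p) := by rw [hA]; ring
  rw [h3]
  field_simp
  ring

/-- Polynomial survival bound of order greater than one from a Foster–Lyapunov inequality. -/
lemma survival_le_of_drift_of_one_lt {f : X → ℝ} (hf : ∀ z, 0 ≤ f z)
    (hpos : ∀ x : X, a < |(x : ℝ)| → 0 < f x)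
    (hint : ∀ x : X, a < |(x : ℝ)| → Integrable f (P x)) {ε p : ℝ} (hε : 0 < ε) (hp1 : 1 < p)
    (hdrift : ∀ x : X, a < |(x : ℝ)| → ∫ z, f z ∂P x ≤ f x - ε * f x ^ (1 - 1 / p))
    {n : ℕ} (hn : 1 ≤ n) (x : X) :
    survival P a n x ≤ (p / ε) ^ p * f x * (n : ℝ) ^ (-p) := by
  have hn0 : (0 : ℝ) < n := by exact_mod_cast hn
  have hp : 0 < p := by linarith
  -- With this value the tangent correction `C f ^ (1 / p - 1) · ε f ^ (1 - 1 / p)` is exactly `p`.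
  set C := p / ε with hC
  have hC0 : 0 < C := by positivity
  -- The time shift `s` is what makes the induction close: one step turns `(n + 1, s)` into `(n, s +
  -- 1)` and leaves `n + s` unchanged. Only `s = 0` is used at the end.
  have key : ∀ n : ℕ, ∀ s : ℝ, 0 ≤ s → ∀ x, survival P a n x * (n + s) ^ p ≤
      (C * f x ^ (1 / p) + s) ^ p := by
    intro n
    induction n with
    | zero =>
      intro s hs x
      have h1 := survival_le_one P a 0 x
      have hfx : 0 ≤ f x ^ (1 / p) := Real.rpow_nonneg (hf x) _
      calc survival P a 0 x * ((0 : ℕ) + s) ^ p ≤ 1 * ((0 : ℕ) + s) ^ p := by gcongr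
        _ = s ^ p := by simp
        _ ≤ _ := by
          refine Real.rpow_le_rpow hs ?_ hp.le
          nlinarith
    | succ n ih =>
      intro s hs x
      have hfx0 : 0 ≤ f x ^ (1 / p) := Real.rpow_nonneg (hf x) _
      rcases le_or_gt |(x : ℝ)| a with hx | hx
      · rw [survival_of_le P _ hx, zero_mul]; positivity
      have hy := hpos x hx
      set A := C * f x ^ (1 / p) + (s + 1) with hA
      have hA1 : 1 ≤ A := by nlinarith
      have hA0 : 0 < A := by linarith
      have h1 : survival P a (n + 1) x * ((n + 1 : ℕ) + s) ^ p ≤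
          A ^ p + A ^ (p - 1) * (C * f x ^ (1 / p - 1) * (∫ z, f z ∂P x - f x)) := by
        have hsub : Integrable (fun z => f z - f x) (P x) :=
          (hint x hx).sub (integrable_const _)
        have hI : ∫ z, (A ^ p + A ^ (p - 1) * (C * f x ^ (1 / p - 1) * (f z - f x))) ∂P x =
            A ^ p + A ^ (p - 1) * (C * f x ^ (1 / p - 1) * (∫ z, f z ∂P x - f x)) := by
          rw [integral_add (integrable_const _)
            ((hsub.const_mul _).const_mul _),
            integral_const_mul, integral_const_mul, integral_sub (hint x hx) (integrable_const _)]
          simp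
        rw [← hI, survival_succ P n hx, ← integral_mul_const]
        refine integral_mono ((integrable_survival P a n x).mul_const _)
          ((integrable_const _).add
            ((hsub.const_mul _).const_mul _)) fun z => ?_
        have h2 := ih (s + 1) (by linarith) z
        have h3 := rpow_tangent_le hp1 hC0 (S := s + 1) (by linarith) hy (hf z)
        have h4 : ((n + 1 : ℕ) : ℝ) + s = n + (s + 1) := by push_cast; ring
        simp only [h4]
        exact h2.trans h3
      have h2 : C * f x ^ (1 / p - 1) * (∫ z, f z ∂P x - f x) ≤ -p := by
        have h3 : ∫ z, f z ∂P x - f x ≤ - (ε * f x ^ (1 - 1 / p)) := by linarith [hdrift x hx]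
        have h5 : 0 < f x ^ (1 / p - 1) := Real.rpow_pos_of_pos hy _
        calc C * f x ^ (1 / p - 1) * (∫ z, f z ∂P x - f x)
            ≤ C * f x ^ (1 / p - 1) * - (ε * f x ^ (1 - 1 / p)) := by gcongr
          _ = -(C * ε * (f x ^ (1 / p - 1) * f x ^ (1 - 1 / p))) := by ring
          _ = -p := by
            rw [← Real.rpow_add hy, hC]
            have : 1 / p - 1 + (1 - 1 / p) = 0 := by ring
            rw [this, Real.rpow_zero]
            field_simp
      -- Bernoulli's inequality: the mean loss of `p A ^ (p - 1)` brings the base back from `s + 1`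
      -- to `s`.
      have h3 : A ^ p - p * A ^ (p - 1) ≤ (A - 1) ^ p := by
        have h4 := one_add_mul_self_le_rpow_one_add (s := -(1 / A)) (p := p)
          (by rw [neg_le_neg_iff, div_le_one hA0]; exact hA1) hp1.le
        have h5 : A - 1 = A * (1 + -(1 / A)) := by field_simp; ring
        have h6 : 0 ≤ 1 + -(1 / A) := by
          have : 1 / A ≤ 1 := by rw [div_le_one hA0]; exact hA1
          linarith
        rw [h5, Real.mul_rpow hA0.le h6]
        refine le_trans (le_of_eq ?_) (mul_le_mul_of_nonneg_left h4 (by positivity))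
        rw [Real.rpow_sub hA0, Real.rpow_one]
        field_simp
        ring
      have h4 : 0 ≤ A ^ (p - 1) := by positivity
      have h5 := mul_le_mul_of_nonneg_left h2 h4
      have h6 : A - 1 = C * f x ^ (1 / p) + s := by rw [hA]; ring
      rw [← h6]
      linarith
  have := key n 0 le_rfl x
  rw [add_zero, add_zero, Real.mul_rpow hC0.le (Real.rpow_nonneg (hf x) _),
    ← Real.rpow_mul (hf x), one_div_mul_cancel hp.ne', Real.rpow_one] at this
  rw [Real.rpow_neg hn0.le, ← div_eq_mul_inv, le_div_iff₀ (by positivity)]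
  exact this

/-- Optional stopping on leaving the annulus between `a` and `R`: `G` contributes nothing positive
at the inner exit, and at most `ρ`, a lower bound for survival, at the outer one. -/
lemma le_survival_of_submartingale {G : X → ℝ} {ρ R : ℝ} {n : ℕ}
    (hG0 : ∀ x : X, |(x : ℝ)| ≤ a → G x ≤ 0) (hint : ∀ x : X, a < |(x : ℝ)| → Integrable G (P x))
    (hGρ : ∀ x, G x ≤ ρ) (hρ : ρ ≤ 1)
    (hfar : ∀ x : X, R ≤ |(x : ℝ)| → ∀ k ≤ n, ρ ≤ survival P a k x)
    (hsub : ∀ x : X, a < |(x : ℝ)| → |(x : ℝ)| < R → G x ≤ ∫ z, G z ∂P x) :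
    ∀ k ≤ n, ∀ x : X, G x ≤ survival P a k x := by
  intro k
  induction k with
  | zero =>
    intro _ x
    rcases le_or_gt |(x : ℝ)| a with hx | hx
    · exact (hG0 x hx).trans (survival_nonneg P a 0 x)
    · rw [survival_zero P hx]; exact (hGρ x).trans hρ
  | succ k ih =>
    intro hk x
    rcases le_or_gt |(x : ℝ)| a with hx | hx
    · exact (hG0 x hx).trans (survival_nonneg P a _ x)
    rcases le_or_gt R |(x : ℝ)| with hR | hR
    · exact (hGρ x).trans (hfar x hR _ hk)
    · rw [survival_succ P k hx]
      exact (hsub x hx hR).trans (integral_mono (hint x hx) (integrable_survival P a k x)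
        fun z => ih (by omega) z)

/-- A maximal inequality for an almost supermartingale: the probability of entering `[-a, a]` by
time `n` is at most the initial value plus the error `e` accumulated over `n` steps. -/
lemma one_sub_survival_le {D : X → ℝ} {e : ℝ} (hD : ∀ x, 0 ≤ D x)
    (hD1 : ∀ x : X, |(x : ℝ)| ≤ a → 1 ≤ D x) (he : 0 ≤ e)
    (hint : ∀ x : X, a < |(x : ℝ)| → Integrable D (P x))
    (hsup : ∀ x : X, a < |(x : ℝ)| → ∫ z, D z ∂P x ≤ D x + e) (n : ℕ) (x : X) :
    1 - survival P a n x ≤ D x + n * e := by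
  induction n generalizing x with
  | zero =>
    rcases le_or_gt |(x : ℝ)| a with hx | hx
    · have := hD1 x hx
      have := survival_nonneg P a 0 x
      simp; linarith
    · rw [survival_zero P hx]; simpa using hD x
  | succ n ih =>
    rcases le_or_gt |(x : ℝ)| a with hx | hx
    · have h1 := hD1 x hx
      have h2 := survival_nonneg P a (n + 1) x
      have h3 : 0 ≤ ((n + 1 : ℕ) : ℝ) * e := by positivity
      linarith
    · rw [survival_succ P n hx]
      have h1 : 1 - ∫ z, survival P a n z ∂P x = ∫ z, (1 - survival P a n z) ∂P x := by
        rw [integral_sub (integrable_const _) (integrable_survival P a n x)]; simp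
      have h2 : ∫ z, (1 - survival P a n z) ∂P x ≤ ∫ z, (D z + n * e) ∂P x :=
        integral_mono ((integrable_const _).sub (integrable_survival P a n x))
          ((hint x hx).add (integrable_const _)) fun z => ih z
      rw [integral_add (hint x hx) (integrable_const _)] at h2
      have h3 := hsup x hx
      simp only [integral_const, probReal_univ, one_smul] at h2
      push_cast
      linarith

end Lyapunov

/-! ### The jump integral and the critical exponent -/

section JumpIntegral

/-- `∫₀^∞ ((1 + u) ^ (ν - 1) - 1) u ^ (-α) du`, the normalised effect of the heavy outward tail on
the Lyapunov function `|x| ^ ν`. -/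
def jumpIntegral (α ν : ℝ) : ℝ := ∫ u in Ioi (0 : ℝ), ((1 + u) ^ (ν - 1) - 1) * u ^ (-α)

lemma abs_one_add_rpow_sub_one_le_self {s u : ℝ} (hs : -1 ≤ s) (hs1 : s ≤ 1) (hu : 0 ≤ u) :
    |(1 + u) ^ s - 1| ≤ u := by
  have h1u : 0 < 1 + u := by linarith
  rw [abs_le]
  constructor
  · have h1 : (1 + u) ^ (-1 : ℝ) ≤ (1 + u) ^ s := Real.rpow_le_rpow_of_exponent_le (by linarith) hs
    have h2 : 1 - u ≤ (1 + u) ^ (-1 : ℝ) := by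
      rw [Real.rpow_neg_one, ← one_div, le_div_iff₀ h1u]; nlinarith
    linarith
  · have := Real.rpow_le_rpow_of_exponent_le (x := 1 + u) (by linarith) hs1
    rw [Real.rpow_one] at this
    linarith

lemma abs_one_add_rpow_sub_one_le_add {s u : ℝ} (hs1 : s ≤ 1) (hu : 0 < u) :
    |(1 + u) ^ s - 1| ≤ 1 + u ^ s := by
  have h1u : 0 < 1 + u := by linarith
  have hp : 0 < (1 + u) ^ s := Real.rpow_pos_of_pos h1u _
  have hq : 0 < u ^ s := Real.rpow_pos_of_pos hu _
  rw [abs_le]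
  constructor
  · linarith
  · rcases le_or_gt s 0 with h | h
    · have := Real.rpow_le_rpow_of_nonpos hu (by linarith : u ≤ 1 + u) h
      linarith
    · have := Real.rpow_add_le_add_rpow zero_le_one hu.le h.le hs1
      rw [Real.one_rpow] at this
      linarith

/-- At `0` the linear bound leaves `u ^ (1 - α)`, integrable since `α < 2`; at infinity `1 + u ^ s`
leaves `u ^ (-α)` and `u ^ (s - α)`, integrable since `α > 1` and `s < α - 1`. -/
lemma integrableOn_abs_one_add_rpow_sub_one_mul {α s : ℝ} (hα1 : 1 < α) (hα2 : α < 2)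
    (hs : -1 ≤ s) (hsα : s < α - 1) :
    IntegrableOn (fun u : ℝ => |(1 + u) ^ s - 1| * u ^ (-α)) (Ioi 0) := by
  have hmeas : Measurable fun u : ℝ => |(1 + u) ^ s - 1| * u ^ (-α) := by fun_prop
  rw [← Ioc_union_Ioi_eq_Ioi (zero_le_one' ℝ)]
  refine IntegrableOn.union ?_ ?_
  · have h1 : IntegrableOn (fun u : ℝ => u ^ (1 - α)) (Ioc 0 1) := by
      rw [← intervalIntegrable_iff_integrableOn_Ioc_of_le zero_le_one]
      exact intervalIntegral.intervalIntegrable_rpow' (by linarith)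
    refine h1.mono' hmeas.aestronglyMeasurable ?_
    filter_upwards [ae_restrict_mem measurableSet_Ioc] with u hu
    have hu0 : 0 < u := hu.1
    rw [Real.norm_of_nonneg (by positivity), Real.rpow_sub hu0, Real.rpow_one,
      Real.rpow_neg hu0.le, div_eq_mul_inv]
    gcongr
    exact abs_one_add_rpow_sub_one_le_self hs (by linarith) hu0.le
  · have h1 : IntegrableOn (fun u : ℝ => u ^ (-α) + u ^ (s - α)) (Ioi 1) :=
      (integrableOn_Ioi_rpow_of_lt (by linarith) one_pos).add
        (integrableOn_Ioi_rpow_of_lt (by linarith) one_pos)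
    refine h1.mono' hmeas.aestronglyMeasurable ?_
    filter_upwards [ae_restrict_mem measurableSet_Ioi] with u hu
    have hu0 : 0 < u := lt_trans one_pos hu
    rw [Real.norm_of_nonneg (by positivity), sub_eq_add_neg s α, Real.rpow_add hu0]
    have := abs_one_add_rpow_sub_one_le_add (s := s) (by linarith) hu0
    have h2 : 0 < u ^ (-α) := by positivity
    nlinarith

lemma integrableOn_one_add_rpow_sub_one_mul {α s : ℝ} (hα1 : 1 < α) (hα2 : α < 2)
    (hs : -1 ≤ s) (hsα : s < α - 1) :
    IntegrableOn (fun u : ℝ => ((1 + u) ^ s - 1) * u ^ (-α)) (Ioi 0) := by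
  refine (integrableOn_abs_one_add_rpow_sub_one_mul hα1 hα2 hs hsα).mono'
    (by fun_prop) ?_
  filter_upwards [ae_restrict_mem measurableSet_Ioi] with u hu
  have hu0 : (0 : ℝ) < u := hu
  rw [norm_mul, Real.norm_eq_abs, Real.norm_of_nonneg (by positivity)]

/-- The integrand increases strictly with `ν`. This gives uniqueness of the critical exponent and
the sign of the drift of `|x| ^ ν` on either side of it. -/
lemma jumpIntegral_lt {α ν ν' : ℝ} (hα1 : 1 < α) (hα2 : α < 2) (hν : 0 < ν) (hνν' : ν < ν')
    (hν' : ν' < α) : jumpIntegral α ν < jumpIntegral α ν' := by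
  unfold jumpIntegral
  have h1 := integrableOn_one_add_rpow_sub_one_mul hα1 hα2 (s := ν - 1) (by linarith) (by linarith)
  have h2 := integrableOn_one_add_rpow_sub_one_mul hα1 hα2 (s := ν' - 1) (by linarith)
    (by linarith)
  rw [← sub_pos, ← integral_sub h2 h1]
  have hpos : ∀ u ∈ Ioi (0 : ℝ), 0 < ((1 + u) ^ (ν' - 1) - 1) * u ^ (-α) -
      ((1 + u) ^ (ν - 1) - 1) * u ^ (-α) := by
    intro u hu
    have hu0 : (0 : ℝ) < u := hu
    have h3 : (1 + u) ^ (ν - 1) < (1 + u) ^ (ν' - 1) :=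
      Real.rpow_lt_rpow_of_exponent_lt (by linarith) (by linarith)
    have h4 : 0 < u ^ (-α) := by positivity
    nlinarith
  have h3 : IntegrableOn (fun u : ℝ => ((1 + u) ^ (ν' - 1) - 1) * u ^ (-α) -
      ((1 + u) ^ (ν - 1) - 1) * u ^ (-α)) (Ioi 0) := h2.sub h1
  rw [setIntegral_pos_iff_support_of_nonneg_ae _ h3]
  · refine lt_of_lt_of_le (b := volume (Ioi (0 : ℝ))) (by simp) (measure_mono fun u hu => ?_)
    exact ⟨(hpos u hu).ne', hu⟩
  · filter_upwards [ae_restrict_mem measurableSet_Ioi] with u hu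
    exact (hpos u hu).le

/-- The substitution `y = u / (1 + u)` turns the normalisation of the beta density on `(0, 1)` into
this integral. -/
lemma lintegral_rpow_mul_one_add_rpow {p q : ℝ} (hp : 0 < p) (hq : 0 < q) :
    ∫⁻ u in Ioi (0 : ℝ), ENNReal.ofReal (1 / beta p q * (u ^ (p - 1) * (1 + u) ^ (-(p + q)))) = 1 := by
  rw [← lintegral_betaPDF_eq_one hp hq, lintegral_betaPDF]
  have himg : (fun u : ℝ => 1 - (1 + u)⁻¹) '' Ioi 0 = Ioo 0 1 := by
    ext y
    simp only [mem_image, mem_Ioi, mem_Ioo]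
    constructor
    · rintro ⟨u, hu, rfl⟩
      have h1 : (1 + u)⁻¹ < 1 := inv_lt_one_of_one_lt₀ (by linarith)
      have h2 : 0 < (1 + u)⁻¹ := by positivity
      constructor <;> linarith
    · rintro ⟨h0, h1⟩
      refine ⟨(1 - y)⁻¹ - 1, ?_, ?_⟩
      · have := one_lt_inv₀ (by linarith : 0 < 1 - y) |>.2 (by linarith)
        linarith
      · simp
  rw [← himg, lintegral_image_eq_lintegral_abs_deriv_mul measurableSet_Ioi
    (f' := fun u => ((1 + u) ^ 2)⁻¹)]
  · refine setLIntegral_congr_fun measurableSet_Ioi fun u hu => ?_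
    have hu0 : (0 : ℝ) < u := hu
    have h1u : 0 < 1 + u := by linarith
    rw [← ENNReal.ofReal_mul (abs_nonneg _), abs_of_pos (by positivity)]
    congr 1
    have h1 : 1 - (1 + u)⁻¹ = u / (1 + u) := by field_simp; ring
    have h2 : 1 - u / (1 + u) = (1 + u)⁻¹ := by field_simp; ring
    rw [h1, h2, Real.div_rpow hu0.le h1u.le, Real.inv_rpow h1u.le, Real.rpow_neg h1u.le,
      Real.rpow_add h1u, Real.rpow_sub h1u, Real.rpow_sub h1u, Real.rpow_one]
    field_simp
  · intro u hu
    have hu0 : (0 : ℝ) < u := hu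
    have h1 : HasDerivAt (fun u : ℝ => 1 + u) 1 u := by simpa using (hasDerivAt_id u).const_add 1
    have h2 := (h1.inv (by linarith : 1 + u ≠ 0).symm.symm).const_sub 1
    refine (h2.congr_deriv ?_).hasDerivWithinAt
    field_simp
  · intro u hu v hv h
    simpa using h

lemma integrableOn_rpow_mul_one_add_rpow {p q : ℝ} (hp : 0 < p) (hq : 0 < q) :
    IntegrableOn (fun u : ℝ => u ^ (p - 1) * (1 + u) ^ (-(p + q))) (Ioi 0) := by
  have hb := beta_pos hp hq
  have h1 : IntegrableOn (fun u : ℝ => 1 / beta p q * (u ^ (p - 1) * (1 + u) ^ (-(p + q))))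
      (Ioi 0) := by
    refine ⟨by fun_prop, ?_⟩
    rw [hasFiniteIntegral_iff_ofReal, lintegral_rpow_mul_one_add_rpow hp hq]
    · exact ENNReal.one_lt_top
    · filter_upwards [ae_restrict_mem measurableSet_Ioi] with u hu
      have hu0 : (0 : ℝ) < u := hu
      positivity
  refine (h1.const_mul (beta p q)).congr (Eventually.of_forall fun u => ?_)
  field_simp

lemma integral_rpow_mul_one_add_rpow {p q : ℝ} (hp : 0 < p) (hq : 0 < q) :
    ∫ u in Ioi (0 : ℝ), u ^ (p - 1) * (1 + u) ^ (-(p + q)) =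
      Real.Gamma p * Real.Gamma q / Real.Gamma (p + q) := by
  have hb := beta_pos hp hq
  have h1 : ∫ u in Ioi (0 : ℝ), 1 / beta p q * (u ^ (p - 1) * (1 + u) ^ (-(p + q))) = 1 := by
    rw [integral_eq_lintegral_of_nonneg_ae _ (by fun_prop),
      lintegral_rpow_mul_one_add_rpow hp hq, ENNReal.toReal_one]
    filter_upwards [ae_restrict_mem measurableSet_Ioi] with u hu
    have hu0 : (0 : ℝ) < u := hu
    have := hb.le
    simp only [Pi.zero_apply]
    positivity
  rw [integral_const_mul] at h1
  rw [← beta]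
  field_simp at h1
  exact h1

/-- Integration by parts produces the beta integral with parameters `2 - α` and `α - ν`, and `Γ(2 -
α) = (1 - α) Γ(1 - α)` absorbs the factor `1 - α`. The boundary terms vanish because `α < 2` at `0`,
and because `α > 1` and `ν < α` at infinity. -/
lemma jumpIntegral_eq {α ν : ℝ} (hα1 : 1 < α) (hα2 : α < 2) (hν : 0 < ν) (hνα : ν < α) :
    jumpIntegral α ν =
      -((ν - 1) * (Real.Gamma (1 - α) * Real.Gamma (α - ν) / Real.Gamma (2 - ν))) := by
  have hα0 : 1 - α ≠ 0 := by linarith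
  have hbeta := integral_rpow_mul_one_add_rpow (p := 2 - α) (q := α - ν) (by linarith)
    (by linarith)
  have hbetaI := integrableOn_rpow_mul_one_add_rpow (p := 2 - α) (q := α - ν) (by linarith)
    (by linarith)
  have hparts := integral_Ioi_mul_deriv_eq_deriv_mul (a := (0 : ℝ)) (a' := (0 : ℝ)) (b' := (0 : ℝ))
    (u := fun u : ℝ => (1 + u) ^ (ν - 1) - 1) (u' := fun u => (ν - 1) * (1 + u) ^ (ν - 2))
    (v := fun u : ℝ => u ^ (1 - α) / (1 - α)) (v' := fun u => u ^ (-α)) ?_ ?_ ?_ ?_ ?_ ?_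
  · have hG : Real.Gamma (2 - α) = (1 - α) * Real.Gamma (1 - α) := by
      rw [← Real.Gamma_add_one hα0]; congr 1; ring
    have h1 : ∫ u in Ioi (0 : ℝ), (ν - 1) * (1 + u) ^ (ν - 2) * (u ^ (1 - α) / (1 - α)) =
        (ν - 1) / (1 - α) *
          ∫ u in Ioi (0 : ℝ), u ^ (2 - α - 1) * (1 + u) ^ (-(2 - α + (α - ν))) := by
      rw [← integral_const_mul]
      congr 1
      ext u
      rw [show 2 - α - 1 = 1 - α by ring, show -(2 - α + (α - ν)) = ν - 2 by ring]
      ring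
    rw [jumpIntegral, hparts, h1, hbeta, hG, show 2 - α + (α - ν) = 2 - ν by ring]
    field_simp
    ring
  · intro u hu
    have hu0 : (0 : ℝ) < u := hu
    have h1 : HasDerivAt (fun u : ℝ => 1 + u) 1 u := by simpa using (hasDerivAt_id u).const_add 1
    refine ((h1.rpow_const (p := ν - 1) (Or.inl (by linarith))).sub_const 1).congr_deriv ?_
    rw [show ν - 1 - 1 = ν - 2 by ring]; ring
  · intro u hu
    have hu0 : (0 : ℝ) < u := hu
    refine ((Real.hasDerivAt_rpow_const (p := 1 - α) (Or.inl hu0.ne')).div_const (1 - α)).congr_deriv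
      ?_
    rw [show 1 - α - 1 = -α by ring]
    field_simp
  · exact integrableOn_one_add_rpow_sub_one_mul hα1 hα2 (by linarith) (by linarith)
  · refine (hbetaI.const_mul ((ν - 1) / (1 - α))).congr (Eventually.of_forall fun u => ?_)
    simp only [Pi.mul_apply]
    rw [show 2 - α - 1 = 1 - α by ring, show -(2 - α + (α - ν)) = ν - 2 by ring]
    ring
  · have h0 : Tendsto (fun u : ℝ => u ^ (2 - α) / (α - 1)) (𝓝[>] 0) (𝓝 0) := by
      have := ((Real.continuousAt_rpow_const 0 (2 - α) (Or.inr (by linarith))).tendsto.mono_left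
        (nhdsWithin_le_nhds (s := Ioi (0 : ℝ)))).div_const (α - 1)
      rwa [Real.zero_rpow (by linarith), zero_div] at this
    refine squeeze_zero_norm' ?_ h0
    filter_upwards [self_mem_nhdsWithin] with u hu
    have hu0 : (0 : ℝ) < u := hu
    have h1 := abs_one_add_rpow_sub_one_le_self (s := ν - 1) (by linarith) (by linarith) hu0.le
    simp only [Pi.mul_apply]
    rw [norm_mul, norm_div, Real.norm_eq_abs, Real.norm_of_nonneg (by positivity : 0 ≤ u ^ (1 - α)),
      Real.norm_eq_abs (1 - α), abs_of_neg (by linarith : 1 - α < 0),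
      show 2 - α = 1 + (1 - α) by ring, Real.rpow_add hu0, Real.rpow_one, neg_sub, mul_div_assoc]
    have h2 : 0 ≤ u ^ (1 - α) / (α - 1) := div_nonneg (by positivity) (by linarith)
    gcongr
  · have h0 : Tendsto (fun u : ℝ => (u ^ (-(α - 1)) + u ^ (-(α - ν))) / (α - 1)) atTop (𝓝 0) := by
      have := ((tendsto_rpow_neg_atTop (by linarith : 0 < α - 1)).add
        (tendsto_rpow_neg_atTop (by linarith : 0 < α - ν))).div_const (α - 1)
      simpa using this
    refine squeeze_zero_norm' ?_ h0
    filter_upwards [eventually_gt_atTop 0] with u hu0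
    have h1 := abs_one_add_rpow_sub_one_le_add (s := ν - 1) (by linarith) hu0
    simp only [Pi.mul_apply]
    rw [norm_mul, norm_div, Real.norm_eq_abs, Real.norm_of_nonneg (by positivity : 0 ≤ u ^ (1 - α)),
      Real.norm_eq_abs (1 - α), abs_of_neg (by linarith : 1 - α < 0), neg_sub,
      neg_sub, show -(α - ν) = ν - 1 + (1 - α) by ring, Real.rpow_add hu0, ← mul_div_assoc]
    have h2 : 0 < u ^ (1 - α) := by positivity
    have h3 : 0 < α - 1 := by linarith
    gcongr
    nlinarith

lemma isCriticalExponent_iff {α b c ν : ℝ} (hα1 : 1 < α) (hα2 : α < 2) :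
    IsCriticalExponent α b c ν ↔ ν ∈ Ioo 0 α ∧ b / c = -jumpIntegral α ν := by
  refine and_congr_right fun h => ?_
  rw [jumpIntegral_eq hα1 hα2 h.1 h.2, neg_neg]

lemma isCriticalExponent_zero_one {α c : ℝ} (hα1 : 1 < α) : IsCriticalExponent α 0 c 1 :=
  ⟨⟨one_pos, hα1⟩, by simp⟩

/-- At `ν = 0` the right-hand side is `-Γ(α) Γ(1 - α) = π |csc(π α)|` by the reflection formula,
strictly above `b / c`; at `α` it tends to `-∞` because of the pole of `Γ(α - ν)`. The intermediate
value theorem gives existence, monotonicity of `jumpIntegral` uniqueness. -/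
lemma existsUnique_isCriticalExponent {α b c : ℝ} (hα1 : 1 < α) (hα2 : α < 2) (hc : 0 < c)
    (hb : b < c * Real.pi * |1 / Real.sin (Real.pi * α)|) :
    ∃! ν : ℝ, IsCriticalExponent α b c ν := by
  have hex : ∃ ν : ℝ, IsCriticalExponent α b c ν := by
    set g : ℝ → ℝ := fun ν =>
      (ν - 1) * (Real.Gamma (1 - α) * Real.Gamma (α - ν) / Real.Gamma (2 - ν)) with hg
    have hGneg : Real.Gamma (1 - α) < 0 := by
      have h1 : Real.Gamma (2 - α) = (1 - α) * Real.Gamma (1 - α) := by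
        rw [← Real.Gamma_add_one (by linarith)]; congr 1; ring
      have h2 : 0 < Real.Gamma (2 - α) := Real.Gamma_pos_of_pos (by linarith)
      by_contra h3
      nlinarith [not_lt.1 h3]
    have hΓc : ∀ x : ℝ, 0 < x → ContinuousAt Real.Gamma x := fun x hx =>
      (Real.differentiableAt_Gamma fun m => by
        have : (0 : ℝ) ≤ m := Nat.cast_nonneg m
        linarith).continuousAt
    have hcont : ContinuousOn g (Ico 0 α) := by
      intro ν hν
      refine ContinuousAt.continuousWithinAt ?_
      have h1 : ContinuousAt (fun ν : ℝ => Real.Gamma (α - ν)) ν :=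
        ContinuousAt.comp (f := fun ν : ℝ => α - ν) (hΓc _ (by linarith [hν.2])) (by fun_prop)
      have h2 : ContinuousAt (fun ν : ℝ => Real.Gamma (2 - ν)) ν :=
        ContinuousAt.comp (f := fun ν : ℝ => 2 - ν) (hΓc _ (by linarith [hν.2])) (by fun_prop)
      exact (continuousAt_id.sub continuousAt_const).mul ((continuousAt_const.mul h1).div h2
        (Real.Gamma_pos_of_pos (by linarith [hν.2])).ne')
    have hg0 : b / c < g 0 := by
      have hsin : Real.sin (Real.pi * α) < 0 := by
        have h1 : Real.sin (Real.pi * α - Real.pi) = -Real.sin (Real.pi * α) := Real.sin_sub_pi _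
        have h2 : 0 < Real.sin (Real.pi * α - Real.pi) := by
          refine Real.sin_pos_of_pos_of_lt_pi ?_ ?_ <;> nlinarith [Real.pi_pos]
        linarith
      have h1 : g 0 = -(Real.Gamma α * Real.Gamma (1 - α)) := by
        simp only [hg, sub_zero, Real.Gamma_two]; ring
      rw [h1, Real.Gamma_mul_Gamma_one_sub, div_lt_iff₀ hc]
      rw [abs_of_neg (div_neg_of_pos_of_neg one_pos hsin)] at hb
      refine hb.trans_le (le_of_eq ?_)
      field_simp
    have hlim : Tendsto g (𝓝[<] α) atBot := by
      have h1 : Tendsto (fun ν : ℝ => α - ν) (𝓝[<] α) (𝓝[>] 0) := by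
        refine tendsto_nhdsWithin_iff.2 ⟨?_, ?_⟩
        · have : Tendsto (fun ν : ℝ => α - ν) (𝓝 α) (𝓝 (α - α)) := by
            exact (continuous_const.sub continuous_id).tendsto α
          rw [sub_self] at this
          exact this.mono_left nhdsWithin_le_nhds
        · filter_upwards [self_mem_nhdsWithin] with ν hν
          exact sub_pos.2 (mem_Iio.1 hν)
      have h2 : Tendsto Real.Gamma (𝓝[>] 0) atTop := by
        have h3 : Tendsto (fun x : ℝ => Real.Gamma (x + 1)) (𝓝[>] 0) (𝓝 1) := by
          have h4 : ContinuousAt (fun x : ℝ => Real.Gamma (x + 1)) 0 :=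
            ContinuousAt.comp (f := fun x : ℝ => x + 1) (hΓc _ (by norm_num)) (by fun_prop)
          have h5 := h4.tendsto
          simp only [zero_add, Real.Gamma_one] at h5
          exact h5.mono_left nhdsWithin_le_nhds
        have h6 := (tendsto_inv_nhdsGT_zero (𝕜 := ℝ)).atTop_mul_pos one_pos h3
        refine h6.congr' ?_
        filter_upwards [self_mem_nhdsWithin] with x hx
        have hx0 : (0 : ℝ) < x := hx
        rw [Real.Gamma_add_one hx0.ne']
        field_simp
      have h3 := h2.comp h1
      have h4 : Tendsto (fun ν : ℝ => (ν - 1) * Real.Gamma (1 - α) / Real.Gamma (2 - ν)) (𝓝[<] α)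
          (𝓝 ((α - 1) * Real.Gamma (1 - α) / Real.Gamma (2 - α))) := by
        refine Tendsto.mono_left ?_ nhdsWithin_le_nhds
        have h5 : ContinuousAt (fun ν : ℝ => Real.Gamma (2 - ν)) α :=
          ContinuousAt.comp (f := fun ν : ℝ => 2 - ν) (hΓc _ (by linarith)) (by fun_prop)
        have h6 : ContinuousAt
            (fun ν : ℝ => (ν - 1) * Real.Gamma (1 - α) / Real.Gamma (2 - ν)) α :=
          ((continuousAt_id.sub continuousAt_const).mul continuousAt_const).div h5
            (Real.Gamma_pos_of_pos (by linarith)).ne'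
        exact h6.tendsto
      have h5 : (α - 1) * Real.Gamma (1 - α) / Real.Gamma (2 - α) < 0 :=
        div_neg_of_neg_of_pos (mul_neg_of_pos_of_neg (by linarith) hGneg)
          (Real.Gamma_pos_of_pos (by linarith))
      refine (h3.atTop_mul_neg h5 h4).congr fun ν => ?_
      simp only [hg, Function.comp]
      ring
    obtain ⟨ν₁, hν₁, hν₁I⟩ := ((hlim.eventually_lt_atBot (b / c)).and
      (Ioo_mem_nhdsLT (by linarith : (0 : ℝ) < α))).exists
    have hsub : Icc 0 ν₁ ⊆ Ico 0 α := fun x hx => ⟨hx.1, hx.2.trans_lt hν₁I.2⟩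
    obtain ⟨ν, hν, hgν⟩ := intermediate_value_Icc' hν₁I.1.le (hcont.mono hsub) ⟨hν₁.le, hg0.le⟩
    refine ⟨ν, ⟨?_, hν.2.trans_lt hν₁I.2⟩, hgν.symm⟩
    refine lt_of_le_of_ne hν.1 ?_
    rintro rfl
    exact hg0.ne hgν.symm
  obtain ⟨ν, hν⟩ := hex
  refine ⟨ν, hν, fun ν' hν' => ?_⟩
  rw [isCriticalExponent_iff hα1 hα2] at hν hν'
  have heq : jumpIntegral α ν = jumpIntegral α ν' := by linarith [hν.2, hν'.2]
  rcases lt_trichotomy ν' ν with h | h | h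
  · exact absurd heq (jumpIntegral_lt hα1 hα2 hν'.1.1 h hν.1.2).ne'
  · exact h
  · exact absurd heq (jumpIntegral_lt hα1 hα2 hν.1.1 h hν'.1.2).ne

end JumpIntegral

/-! ### Moment estimates for heavy-tailed increments -/

section Increments

/-- The measures `m i`, `i ∈ S`, have a right tail asymptotic to `c * y ^ (-α)` and a left tail with
a finite moment of order `β`, uniformly in `i`. -/
structure HeavyRightTail {ι : Type*} (m : ι → Measure ℝ) (S : Set ι) (α β c : ℝ) : Prop where
  prob : ∀ i, IsProbabilityMeasure (m i)
  one_lt_alpha : 1 < α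
  alpha_lt_two : α < 2
  alpha_lt_beta : α < β
  c_pos : 0 < c
  right : TendstoUniformlyOn (fun (y : ℝ) (i : ι) => y ^ α * (m i).real (Ioi y)) (fun _ => c)
    atTop S
  left : ∃ M : ℝ, 0 ≤ M ∧ ∀ i ∈ S, ∫⁻ t, ENNReal.ofReal (max (-t) 0 ^ β) ∂m i ≤ ENNReal.ofReal M

/-- The measures `m i`, `i ∈ S`, have tails of order `-α`, uniformly. -/
def HasTailBound {ι : Type*} (m : ι → Measure ℝ) (S : Set ι) (α C : ℝ) : Prop :=
  ∀ i ∈ S, ∀ t : ℝ, 0 < t → m i {θ | t < |θ|} ≤ ENNReal.ofReal (C * t ^ (-α))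

variable {ι : Type*} {m : ι → Measure ℝ} {S : Set ι} {α β c C : ℝ}

lemma HeavyRightTail.exists_hasTailBound (h : HeavyRightTail m S α β c) :
    ∃ C : ℝ, 0 < C ∧ HasTailBound m S α C := by
  obtain ⟨M, hM0, hM⟩ := h.left
  have h1 := Metric.tendstoUniformlyOn_iff.1 h.right 1 one_pos
  obtain ⟨Y, hY⟩ := eventually_atTop.1 h1
  have hc := h.c_pos
  have hα := h.one_lt_alpha
  set Y' := max Y 1
  have hY'1 : 1 ≤ Y' := le_max_right _ _
  have hY'0 : 0 < Y' := by linarith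
  -- `c + 1` bounds the right tail beyond `Y'`, `M` the left tail there by Markov's inequality, and
  -- `Y' ^ α` covers `t < Y'`, where the trivial bound `1` is enough.
  refine ⟨c + 1 + M + Y' ^ α, by positivity, fun i hi t ht => ?_⟩
  have := h.prob i
  have htα : 0 < t ^ (-α) := by positivity
  rcases le_or_gt Y' t with hYt | hYt
  · have ht1 : 1 ≤ t := hY'1.trans hYt
    have hsub : {θ : ℝ | t < |θ|} ⊆ Ioi t ∪ {θ | t ^ β ≤ max (-θ) 0 ^ β} := by
      intro θ hθ
      rcases lt_abs.1 (mem_ofPred_eq ▸ hθ) with h1 | h1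
      · exact Or.inl h1
      · right
        refine Real.rpow_le_rpow ht.le ?_ (by linarith [h.alpha_lt_beta])
        exact h1.le.trans (le_max_left _ _)
    have hright : m i (Ioi t) ≤ ENNReal.ofReal ((c + 1) * t ^ (-α)) := by
      have h2 := hY t ((le_max_left _ _).trans hYt) i hi
      rw [Real.dist_eq, abs_sub_comm] at h2
      have h3 := (abs_lt.1 h2).2
      rw [← ofReal_measureReal]
      refine ENNReal.ofReal_le_ofReal ?_
      rw [Real.rpow_neg ht.le, ← div_eq_mul_inv, le_div_iff₀ (by positivity)]
      linarith
    have hleft : m i {θ | t ^ β ≤ max (-θ) 0 ^ β} ≤ ENNReal.ofReal (M * t ^ (-α)) := by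
      have h2 := mul_meas_ge_le_lintegral₀ (μ := m i)
        (f := fun θ => ENNReal.ofReal (max (-θ) 0 ^ β)) (by fun_prop) (ENNReal.ofReal (t ^ β))
      have h3 : {θ : ℝ | t ^ β ≤ max (-θ) 0 ^ β} ⊆
          {θ | ENNReal.ofReal (t ^ β) ≤ ENNReal.ofReal (max (-θ) 0 ^ β)} :=
        fun θ hθ => ENNReal.ofReal_le_ofReal hθ
      have htβ : 0 < t ^ β := by positivity
      have h4 : m i {θ | t ^ β ≤ max (-θ) 0 ^ β} ≤ ENNReal.ofReal M / ENNReal.ofReal (t ^ β) := by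
        rw [ENNReal.le_div_iff_mul_le (Or.inl (by simpa using htβ)) (Or.inl ENNReal.ofReal_ne_top),
          mul_comm]
        exact ((mul_le_mul_right (measure_mono h3) _).trans h2).trans (hM i hi)
      refine h4.trans ?_
      rw [← ENNReal.ofReal_div_of_pos htβ]
      refine ENNReal.ofReal_le_ofReal ?_
      rw [div_eq_mul_inv, ← Real.rpow_neg ht.le]
      gcongr
      exact h.alpha_lt_beta.le
    calc m i {θ | t < |θ|} ≤ m i (Ioi t ∪ {θ | t ^ β ≤ max (-θ) 0 ^ β}) := measure_mono hsub
      _ ≤ _ := measure_union_le _ _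
      _ ≤ ENNReal.ofReal ((c + 1) * t ^ (-α)) + ENNReal.ofReal (M * t ^ (-α)) :=
          add_le_add hright hleft
      _ ≤ _ := by
          rw [← ENNReal.ofReal_add (by positivity) (by positivity)]
          refine ENNReal.ofReal_le_ofReal ?_
          have : 0 < Y' ^ α := by positivity
          nlinarith
  · calc m i {θ | t < |θ|} ≤ 1 := prob_le_one
      _ = ENNReal.ofReal 1 := by simp
      _ ≤ _ := by
          refine ENNReal.ofReal_le_ofReal ?_
          have h2 : t ^ α ≤ Y' ^ α := Real.rpow_le_rpow ht.le hYt.le (by linarith)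
          have h3 : t ^ α * t ^ (-α) = 1 := by rw [← Real.rpow_add ht]; simp
          nlinarith

/-- Layer cake formula, with `k` a generalised inverse of `h`. The scale `T` factors out as `T ^
(-α)`, leaving an integral independent of `i` and `T`. -/
lemma HasTailBound.lintegral_comp_le (hm : HasTailBound m S α C) (hC : 0 < C)
    {h k : ℝ → ℝ} (hh : Measurable h) (hh0 : ∀ v, 0 ≤ v → 0 ≤ h v) (hk : ∀ s, 0 < s → 0 < k s)
    (hhk : ∀ s v, 0 < s → 0 ≤ v → s < h v → k s < v)
    {i : ι} (hi : i ∈ S) {T : ℝ} (hT : 0 < T) :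
    ∫⁻ θ, ENNReal.ofReal (h (|θ| / T)) ∂m i ≤
      ENNReal.ofReal (C * T ^ (-α)) * ∫⁻ s in Ioi (0 : ℝ), ENNReal.ofReal (k s ^ (-α)) := by
  rw [lintegral_eq_lintegral_meas_lt _ (Eventually.of_forall fun θ => hh0 _ (by positivity))
    (by fun_prop), ← lintegral_const_mul' _ _ ENNReal.ofReal_ne_top]
  refine setLIntegral_mono' measurableSet_Ioi fun s hs => ?_
  have hs0 : (0 : ℝ) < s := hs
  have hks := hk s hs0
  calc m i {θ | s < h (|θ| / T)} ≤ m i {θ | k s * T < |θ|} := by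
        refine measure_mono fun θ hθ => ?_
        have := hhk s _ hs0 (by positivity) hθ
        rwa [lt_div_iff₀ hT] at this
    _ ≤ ENNReal.ofReal (C * (k s * T) ^ (-α)) := hm i hi _ (by positivity)
    _ = _ := by
        rw [← ENNReal.ofReal_mul (by positivity), Real.mul_rpow hks.le hT.le]
        ring_nf

/-- Truncated quadratic moment of a heavy tailed increment. -/
lemma HasTailBound.exists_lintegral_min_le (hm : HasTailBound m S α C) (hα1 : 1 < α) (hα2 : α < 2)
    (hC : 0 < C) : ∃ K : ℝ, 0 ≤ K ∧ ∀ i ∈ S, ∀ T : ℝ, 0 < T →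
      ∫⁻ θ, ENNReal.ofReal (min ((|θ| / T) ^ 2) (|θ| / T)) ∂m i ≤
        ENNReal.ofReal (K * T ^ (-α)) := by
  -- `max s (√s)` inverts `min (v ^ 2) v`. Convergence at `0` needs `α < 2`, at infinity `α > 1`.
  have hfin : ∫⁻ s in Ioi (0 : ℝ), ENNReal.ofReal (max s (√s) ^ (-α)) ≠ ∞ := by
    have hI : IntegrableOn (fun s : ℝ => max s (√s) ^ (-α)) (Ioi 0) := by
      rw [← Ioc_union_Ioi_eq_Ioi (zero_le_one' ℝ)]
      refine IntegrableOn.union ?_ ?_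
      · have h1 : IntegrableOn (fun s : ℝ => s ^ (-α / 2)) (Ioc 0 1) := by
          rw [← intervalIntegrable_iff_integrableOn_Ioc_of_le zero_le_one]
          exact intervalIntegral.intervalIntegrable_rpow' (by linarith)
        refine h1.mono' (Measurable.aestronglyMeasurable (by fun_prop)) ?_
        filter_upwards [ae_restrict_mem measurableSet_Ioc] with s hs
        have hs0 : 0 < s := hs.1
        rw [Real.norm_of_nonneg (by positivity),
          show -α / 2 = 1 / 2 * (-α) by ring, Real.rpow_mul hs0.le, ← Real.sqrt_eq_rpow]
        exact Real.rpow_le_rpow_of_nonpos (by positivity) (le_max_right _ _) (by linarith)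
      · refine (integrableOn_Ioi_rpow_of_lt (by linarith : -α < -1) one_pos).mono'
          (Measurable.aestronglyMeasurable (by fun_prop)) ?_
        filter_upwards [ae_restrict_mem measurableSet_Ioi] with s hs
        have hs0 : 0 < s := lt_trans one_pos hs
        rw [Real.norm_of_nonneg (by positivity)]
        exact Real.rpow_le_rpow_of_nonpos hs0 (le_max_left _ _) (by linarith)
    exact hI.lintegral_lt_top.ne
  refine ⟨C * (∫⁻ s in Ioi (0 : ℝ), ENNReal.ofReal (max s (√s) ^ (-α))).toReal, by positivity,
    fun i hi T hT => ?_⟩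
  refine (hm.lintegral_comp_le hC (h := fun v => min (v ^ 2) v)
    (k := fun s => max s (√s)) (by fun_prop) (fun v hv => le_min (by positivity) hv)
    (fun s hs => lt_max_of_lt_left hs) (fun s v hs hv hsv => max_lt (lt_min_iff.1 hsv).2
      ((Real.sqrt_lt' (hs.trans (lt_min_iff.1 hsv).2)).2 (lt_min_iff.1 hsv).1)) hi hT).trans
      (le_of_eq ?_)
  conv_lhs => rw [← ENNReal.ofReal_toReal hfin]
  rw [← ENNReal.ofReal_mul (by positivity)]
  ring_nf

/-- Mean overshoot of a heavy tailed increment above a high level. -/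
lemma HasTailBound.exists_lintegral_overshoot_le (hm : HasTailBound m S α C) {ν : ℝ} (hν : 0 < ν)
    (hνα : ν < α) (hC : 0 < C) : ∃ K : ℝ, 0 ≤ K ∧ ∀ i ∈ S, ∀ T : ℝ, 0 < T →
      ∫⁻ θ, ENNReal.ofReal (|θ| ^ ν - T ^ ν) ∂m i ≤ ENNReal.ofReal (K * T ^ (ν - α)) := by
  have hfin : ∫⁻ s in Ioi (0 : ℝ), ENNReal.ofReal (((s + 1) ^ (1 / ν)) ^ (-α)) ≠ ∞ := by
    have h1 := integrableOn_add_rpow_Ioi_of_lt (a := -α / ν) (c := 0) (m := 1)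
      (by rw [div_lt_iff₀ hν]; linarith) (by norm_num)
    have h2 : IntegrableOn (fun s : ℝ => ((s + 1) ^ (1 / ν)) ^ (-α)) (Ioi 0) := by
      refine h1.congr_fun (fun s hs => ?_) measurableSet_Ioi
      have hs0 : (0 : ℝ) < s := hs
      simp only
      rw [← Real.rpow_mul (by positivity)]
      congr 1
      ring
    exact h2.lintegral_lt_top.ne
  refine ⟨C * (∫⁻ s in Ioi (0 : ℝ), ENNReal.ofReal (((s + 1) ^ (1 / ν)) ^ (-α))).toReal,
    by positivity, fun i hi T hT => ?_⟩
  -- After rescaling by `T` the overshoot is `max (v ^ ν - 1) 0`, with inverse `(s + 1) ^ (1 / ν)`;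
  -- its integral converges since `ν < α`.
  have h1 := hm.lintegral_comp_le hC (h := fun v => max (v ^ ν - 1) 0)
    (k := fun s => (s + 1) ^ (1 / ν)) (by fun_prop) (fun v hv => le_max_right _ _)
    (fun s hs => by positivity) (fun s v hs hv hsv => by
      have h2 : s + 1 < v ^ ν := by
        rcases lt_max_iff.1 hsv with h | h
        · linarith
        · linarith
      calc (s + 1) ^ (1 / ν) < (v ^ ν) ^ (1 / ν) :=
            Real.rpow_lt_rpow (by positivity) h2 (by positivity)
        _ = v := by rw [← Real.rpow_mul hv, mul_one_div_cancel hν.ne', Real.rpow_one]) hi hT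
  have h2 : ∀ θ : ℝ, ENNReal.ofReal (|θ| ^ ν - T ^ ν) =
      ENNReal.ofReal (T ^ ν) * ENNReal.ofReal (max ((|θ| / T) ^ ν - 1) 0) := by
    intro θ
    rw [← ENNReal.ofReal_mul (by positivity), mul_max_of_nonneg _ _ (by positivity), mul_sub,
      Real.div_rpow (abs_nonneg _) hT.le]
    have : T ^ ν ≠ 0 := by positivity
    rw [mul_div_cancel₀ _ this, mul_one, mul_zero, ENNReal.ofReal_max]
    simp
  simp_rw [h2]
  rw [lintegral_const_mul _ (by fun_prop)]
  refine (mul_le_mul_right h1 _).trans (le_of_eq ?_)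
  conv_lhs => rw [← ENNReal.ofReal_toReal hfin]
  rw [← ENNReal.ofReal_mul (by positivity), ← ENNReal.ofReal_mul (by positivity),
    Real.rpow_sub hT, Real.rpow_neg hT.le]
  ring_nf

lemma HasTailBound.integrable_abs_rpow (hm : HasTailBound m S α C) {ν : ℝ} (hν : 0 < ν)
    (hνα : ν < α) (hC : 0 < C) {i : ι} (hi : i ∈ S) [IsFiniteMeasure (m i)] :
    Integrable (fun θ => |θ| ^ ν) (m i) := by
  obtain ⟨K, -, hK⟩ := hm.exists_lintegral_overshoot_le hν hνα hC
  have h1 := hK i hi 1 one_pos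
  have h2 : Integrable (fun θ => max (|θ| ^ ν - 1) 0) (m i) := by
    refine ⟨Measurable.aestronglyMeasurable (by fun_prop), ?_⟩
    rw [hasFiniteIntegral_iff_ofReal (f := fun θ => max (|θ| ^ ν - 1) 0) (Eventually.of_forall fun θ => le_max_right _ _)]
    refine lt_of_le_of_lt (le_of_eq (lintegral_congr fun θ => ?_))
      (h1.trans_lt ENNReal.ofReal_lt_top)
    rw [ENNReal.ofReal_max, Real.one_rpow]; simp
  refine (h2.add (integrable_const (1 : ℝ))).mono'
    (Measurable.aestronglyMeasurable (by fun_prop)) (Eventually.of_forall fun θ => ?_)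
  rw [Real.norm_of_nonneg (by positivity)]
  have := le_max_left (|θ| ^ ν - 1) 0
  simp only [Pi.add_apply]
  linarith

lemma HasTailBound.integrable_id (hm : HasTailBound m S α C) (hα1 : 1 < α) (hC : 0 < C) {i : ι}
    (hi : i ∈ S) [IsFiniteMeasure (m i)] : Integrable (fun θ : ℝ => θ) (m i) := by
  have := hm.integrable_abs_rpow one_pos hα1 hC hi
  simp only [Real.rpow_one] at this
  exact (integrable_norm_iff (by fun_prop)).1 this

end Increments

/-! ### Expansion of the mean increment of a power of the distance -/

section PowerIncrement

lemma add_rpow_le_two_rpow_mul {a b ν : ℝ} (ha : 0 ≤ a) (hb : 0 ≤ b) (hν : 0 < ν) :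
    (a + b) ^ ν ≤ 2 ^ ν * (a ^ ν + b ^ ν) := by
  have h1 : (a + b) ^ ν ≤ (2 * max a b) ^ ν := by
    refine Real.rpow_le_rpow (by positivity) ?_ hν.le
    linarith [le_max_left a b, le_max_right a b]
  rw [Real.mul_rpow (by norm_num) (by positivity)] at h1
  refine h1.trans (mul_le_mul_of_nonneg_left ?_ (by positivity))
  have h2 : 0 ≤ a ^ ν := by positivity
  have h3 : 0 ≤ b ^ ν := by positivity
  rcases max_choice a b with h | h <;> rw [h] <;> linarith

/-- The derivative of the Taylor remainder keeps the sign of `ν - 1`, so the absolute value passes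
through the integral. Absolute values supply the nonnegativity needed by the layer cake formula. -/
lemma intervalIntegral_mul_abs_one_add_rpow {ν v : ℝ} (hν : 0 < ν) (hv : 0 ≤ v) :
    ∫ t in (0 : ℝ)..v, ν * |(1 + t) ^ (ν - 1) - 1| = |(1 + v) ^ ν - 1 - ν * v| := by
  have hderiv : ∀ t ∈ uIcc 0 v, HasDerivAt (fun t : ℝ => (1 + t) ^ ν - 1 - ν * t)
      (ν * ((1 + t) ^ (ν - 1) - 1)) t := by
    intro t ht
    rw [uIcc_of_le hv] at ht
    have h1 : HasDerivAt (fun u : ℝ => 1 + u) 1 t := by simpa using (hasDerivAt_id t).const_add 1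
    have h2 := ((h1.rpow_const (p := ν) (Or.inl (by linarith [ht.1]))).sub_const 1).sub
      ((hasDerivAt_id t).const_mul ν)
    exact h2.congr_deriv (by ring)
  have hcont : ContinuousOn (fun t : ℝ => ν * ((1 + t) ^ (ν - 1) - 1)) (uIcc 0 v) := by
    intro t ht
    rw [uIcc_of_le hv] at ht
    refine ContinuousAt.continuousWithinAt ?_
    refine continuousAt_const.mul (ContinuousAt.sub ?_ continuousAt_const)
    exact ContinuousAt.rpow_const (by fun_prop) (Or.inl (by linarith [ht.1]))
  have hint := intervalIntegral.integral_eq_sub_of_hasDerivAt hderiv hcont.intervalIntegrable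
  simp only [add_zero, Real.one_rpow, sub_self, mul_zero, sub_zero] at hint
  rcases le_total 1 ν with h | h
  · have h1 : ∫ t in (0 : ℝ)..v, ν * |(1 + t) ^ (ν - 1) - 1| =
        ∫ t in (0 : ℝ)..v, ν * ((1 + t) ^ (ν - 1) - 1) := by
      refine intervalIntegral.integral_congr fun t ht => ?_
      rw [uIcc_of_le hv] at ht
      rw [abs_of_nonneg]
      have := Real.one_le_rpow (x := 1 + t) (by linarith [ht.1]) (by linarith : 0 ≤ ν - 1)
      linarith
    rw [h1, hint, abs_of_nonneg]
    have := one_add_mul_self_le_rpow_one_add (s := v) (by linarith) h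
    linarith
  · have h1 : ∫ t in (0 : ℝ)..v, ν * |(1 + t) ^ (ν - 1) - 1| =
        ∫ t in (0 : ℝ)..v, -(ν * ((1 + t) ^ (ν - 1) - 1)) := by
      refine intervalIntegral.integral_congr fun t ht => ?_
      rw [uIcc_of_le hv] at ht
      rw [abs_of_nonpos, mul_neg]
      have := Real.rpow_le_one_of_one_le_of_nonpos (x := 1 + t) (by linarith [ht.1])
        (by linarith : ν - 1 ≤ 0)
      linarith
    rw [h1, intervalIntegral.integral_neg, hint, abs_of_nonpos]
    have := rpow_one_add_le_one_add_mul_self (s := v) (by linarith) hν.le h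
    linarith

lemma abs_one_sub_rpow_le {ν κ : ℝ} (hν : 0 < ν) (hνκ : ν ≤ κ) (hκ1 : 1 ≤ κ) (hκ2 : κ ≤ 2) :
    ∃ K : ℝ, 0 ≤ K ∧ ∀ v : ℝ, 0 ≤ v → |(|1 - v| ^ ν - 1 + ν * v)| ≤ K * v ^ κ := by
  -- `2 * ν` comes from the Taylor bound for `v ≤ 1 / 2`. For `v > 1 / 2`, `3 * v ≥ 1` and each of
  -- `|1 - v| ^ ν`, `1` and `v` is at most `(3 * v) ^ κ`.
  refine ⟨2 * ν + (2 + ν) * 3 ^ κ, by positivity, fun v hv => ?_⟩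
  have h3 : (0 : ℝ) ≤ 3 ^ κ := by positivity
  have hvκ : 0 ≤ v ^ κ := by positivity
  rcases le_or_gt v (1 / 2) with h | h
  · have hp : ∀ t ∈ Icc 0 v, HasDerivWithinAt (fun t : ℝ => (1 - t) ^ ν - 1 + ν * t)
        (ν * (1 - (1 - t) ^ (ν - 1))) (Icc 0 v) t := by
      intro t ht
      have h1 : HasDerivAt (fun u : ℝ => 1 - u) (-1) t := by
        simpa using (hasDerivAt_id t).const_sub 1
      have h2 := ((h1.rpow_const (p := ν) (Or.inl (by linarith [ht.2]))).sub_const 1).add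
        ((hasDerivAt_id t).const_mul ν)
      exact (h2.congr_deriv (by ring)).hasDerivWithinAt
    have hb : ∀ t ∈ Ico 0 v, ‖ν * (1 - (1 - t) ^ (ν - 1))‖ ≤ 2 * ν * v := by
      intro t ht
      have hw : 0 < 1 - t := by linarith [ht.2]
      have hw1 : 1 - t ≤ 1 := by linarith [ht.1]
      have h4 : (1 - t) ^ (1 : ℝ) ≤ (1 - t) ^ (ν - 1) :=
        Real.rpow_le_rpow_of_exponent_ge hw hw1 (by linarith)
      have h5 : (1 - t) ^ (ν - 1) ≤ (1 - t) ^ (-1 : ℝ) :=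
        Real.rpow_le_rpow_of_exponent_ge hw hw1 (by linarith)
      rw [Real.rpow_one] at h4
      have h6 : (1 - t) ^ (-1 : ℝ) ≤ 1 + 2 * t := by
        rw [Real.rpow_neg_one, inv_le_iff_one_le_mul₀ hw]
        nlinarith [ht.1, ht.2]
      rw [norm_mul, Real.norm_of_nonneg hν.le, Real.norm_eq_abs]
      have h7 : |1 - (1 - t) ^ (ν - 1)| ≤ 2 * v := by
        rw [abs_le]
        constructor <;> linarith [ht.1, ht.2]
      nlinarith
    have h8 := norm_image_sub_le_of_norm_deriv_le_segment' hp hb v (right_mem_Icc.2 hv)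
    simp only [sub_zero, Real.one_rpow, sub_self, mul_zero, add_zero, Real.norm_eq_abs] at h8
    rw [abs_of_nonneg (by linarith : 0 ≤ 1 - v)]
    refine h8.trans ?_
    have h9 : v * v ≤ v ^ κ := by
      rcases hv.eq_or_lt with h0 | h0
      · rw [← h0]; simp [Real.zero_rpow (by linarith : κ ≠ 0)]
      · have := Real.rpow_le_rpow_of_exponent_ge h0 (by linarith) hκ2
        rw [Real.rpow_two] at this
        nlinarith
    nlinarith [mul_nonneg (mul_nonneg (by linarith : 0 ≤ 2 + ν) h3) hvκ]
  · have h3v : 1 ≤ 3 * v := by linarith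
    have h4 : |1 - v| ^ ν ≤ (3 * v) ^ κ := by
      calc |1 - v| ^ ν ≤ (3 * v) ^ ν := by
            refine Real.rpow_le_rpow (abs_nonneg _) ?_ hν.le
            rw [abs_le]; constructor <;> linarith
        _ ≤ (3 * v) ^ κ := Real.rpow_le_rpow_of_exponent_le h3v hνκ
    have h5 : 1 ≤ (3 * v) ^ κ := Real.one_le_rpow h3v (by linarith)
    have h6 : v ≤ (3 * v) ^ κ := by
      have := Real.rpow_le_rpow_of_exponent_le h3v hκ1
      rw [Real.rpow_one] at this
      linarith
    have h7 : 0 ≤ |1 - v| ^ ν := by positivity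
    rw [Real.mul_rpow (by norm_num) hv] at h4 h5 h6
    have h8 : ν * v ≤ ν * (3 ^ κ * v ^ κ) := by gcongr
    have h9 : 0 ≤ ν * v := by positivity
    have h10 : 0 ≤ 2 * ν * v ^ κ := by positivity
    rw [abs_le]
    constructor <;> linarith

variable {ι : Type*} {m : ι → Measure ℝ} {S : Set ι} {α β c C : ℝ}

lemma HasTailBound.integrable_abs_add_rpow (hm : HasTailBound m S α C) {ν : ℝ} (hν : 0 < ν)
    (hνα : ν < α) (hC : 0 < C) {i : ι} (hi : i ∈ S) [IsFiniteMeasure (m i)] (r : ℝ) :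
    Integrable (fun θ => |r + θ| ^ ν) (m i) := by
  have h1 := ((integrable_const (|r| ^ ν)).add (hm.integrable_abs_rpow hν hνα hC hi)).const_mul
    (2 ^ ν)
  refine h1.mono' (Measurable.aestronglyMeasurable (by fun_prop)) (Eventually.of_forall fun θ => ?_)
  rw [Real.norm_of_nonneg (by positivity)]
  refine (Real.rpow_le_rpow (abs_nonneg _) (abs_add_le r θ) hν.le).trans ?_
  exact add_rpow_le_two_rpow_mul (abs_nonneg _) (abs_nonneg _) hν

lemma HasTailBound.integrable_pos_part (hm : HasTailBound m S α C) (hα1 : 1 < α) {ν : ℝ}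
    (hν : 0 < ν) (hνα : ν < α) (hC : 0 < C) {i : ι} (hi : i ∈ S) [IsFiniteMeasure (m i)] {r : ℝ}
    (hr : 0 < r) :
    Integrable (fun θ => (1 + max θ 0 / r) ^ ν - 1 - ν * (max θ 0 / r)) (m i) := by
  have hmax : Integrable (fun θ : ℝ => max θ 0) (m i) := (hm.integrable_id hα1 hC hi).pos_part
  refine Integrable.sub (Integrable.sub ?_ (integrable_const _)) ((hmax.div_const r).const_mul ν)
  have h1 := ((integrable_const (1 : ℝ)).add
    ((hm.integrable_abs_rpow hν hνα hC hi).div_const (r ^ ν))).const_mul (2 ^ ν)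
  refine h1.mono' (Measurable.aestronglyMeasurable (by fun_prop)) (Eventually.of_forall fun θ => ?_)
  rw [Real.norm_of_nonneg (by positivity)]
  refine (add_rpow_le_two_rpow_mul zero_le_one (by positivity) hν).trans ?_
  simp only [Pi.add_apply, Real.one_rpow]
  gcongr
  rw [Real.div_rpow (le_max_right _ _) hr.le]
  gcongr
  exact max_le (le_abs_self θ) (abs_nonneg θ)

/-- By the layer cake formula the expectation is an integral of `r ^ α P(θ > r u)` against the
derivative of the remainder. This tail tends to `c u ^ (-α)` and is dominated by `C u ^ (-α)`, so
dominated convergence applies. -/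
lemma HeavyRightTail.tendsto_integral_pos_part (h : HeavyRightTail m S α β c) {l : Filter ι}
    [l.IsCountablyGenerated] {r : ι → ℝ} (hr : Tendsto r l atTop) (hS : ∀ᶠ i in l, i ∈ S) {ν : ℝ}
    (hν : 0 < ν) (hνα : ν < α) :
    Tendsto (fun i => r i ^ α *
      ∫ θ, ((1 + max θ 0 / r i) ^ ν - 1 - ν * (max θ 0 / r i)) ∂m i) l
      (𝓝 (c * (ν * jumpIntegral α ν))) := by
  obtain ⟨C, hC, hm⟩ := h.exists_hasTailBound
  have hα1 := h.one_lt_alpha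
  have hα2 := h.alpha_lt_two
  set g : ℝ → ℝ := fun u => ν * |(1 + u) ^ (ν - 1) - 1| with hg
  have hgm : Measurable g := by fun_prop
  have hg0 : ∀ u, 0 ≤ g u := fun u => by positivity
  have hrep : ∀ i ∈ S, 0 < r i →
      r i ^ α * ∫ θ, |(1 + max θ 0 / r i) ^ ν - 1 - ν * (max θ 0 / r i)| ∂m i =
        ∫ u in Ioi (0 : ℝ), r i ^ α * (m i).real (Ioi (r i * u)) * g u := by
    intro i hi hri
    have := h.prob i
    have hcake := lintegral_comp_eq_lintegral_meas_lt_mul (m i) (f := fun θ => max θ 0 / r i)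
      (g := g) (Eventually.of_forall fun θ => by simp only [Pi.zero_apply]; positivity)
      (by fun_prop) (fun t ht => by
        refine ContinuousOn.intervalIntegrable fun u hu => ?_
        rw [uIcc_of_le ht.le] at hu
        refine ContinuousAt.continuousWithinAt (continuousAt_const.mul
          (ContinuousAt.abs (ContinuousAt.sub ?_ continuousAt_const)))
        exact ContinuousAt.rpow_const (by fun_prop) (Or.inl (by linarith [hu.1])))
      (Eventually.of_forall hg0)
    have hleft : ∀ θ : ℝ, ∫ t in (0 : ℝ)..max θ 0 / r i, g t =
        |(1 + max θ 0 / r i) ^ ν - 1 - ν * (max θ 0 / r i)| := fun θ =>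
      intervalIntegral_mul_abs_one_add_rpow hν (by positivity)
    simp_rw [hleft] at hcake
    have hanti : Measurable fun u : ℝ => (m i).real (Ioi (r i * u)) := by
      refine Antitone.measurable fun u v huv => measureReal_mono ?_
      exact Ioi_subset_Ioi (by gcongr)
    simp_rw [mul_assoc]
    rw [integral_const_mul]
    congr 1
    rw [integral_eq_lintegral_of_nonneg_ae (Eventually.of_forall fun θ => abs_nonneg _)
      (Measurable.aestronglyMeasurable (by fun_prop)), hcake,
      integral_eq_lintegral_of_nonneg_ae (Eventually.of_forall fun u => by
        exact mul_nonneg measureReal_nonneg (hg0 u))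
      (f := fun u => (m i).real (Ioi (r i * u)) * g u) (hanti.mul hgm).aestronglyMeasurable]
    congr 1
    refine setLIntegral_congr_fun measurableSet_Ioi fun u hu => ?_
    have hu0 : (0 : ℝ) < u := hu
    rw [ENNReal.ofReal_mul measureReal_nonneg, ofReal_measureReal]
    congr 2
    ext θ
    simp only [mem_ofPred_eq, mem_Ioi]
    rw [lt_div_iff₀ hri, mul_comm, lt_max_iff, or_iff_left]
    have : 0 < r i * u := by positivity
    exact not_lt.2 this.le
  have hlim : Tendsto (fun i => ∫ u in Ioi (0 : ℝ), r i ^ α * (m i).real (Ioi (r i * u)) * g u) l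
      (𝓝 (∫ u in Ioi (0 : ℝ), c * u ^ (-α) * g u)) := by
    refine tendsto_integral_filter_of_dominated_convergence
      (fun u => C * ν * (|(1 + u) ^ (ν - 1) - 1| * u ^ (-α))) ?_ ?_ ?_ ?_
    · filter_upwards [hr.eventually_gt_atTop 0] with i hri
      have := h.prob i
      have hanti : Measurable fun u : ℝ => (m i).real (Ioi (r i * u)) := by
        refine Antitone.measurable fun u v huv => measureReal_mono ?_
        exact Ioi_subset_Ioi (by gcongr)
      exact ((hanti.const_mul _).mul hgm).aestronglyMeasurable
    · filter_upwards [hr.eventually_gt_atTop 0, hS] with i hri hi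
      have := h.prob i
      filter_upwards [ae_restrict_mem measurableSet_Ioi] with u hu
      have hu0 : (0 : ℝ) < u := hu
      have h1 : (m i).real (Ioi (r i * u)) ≤ C * (r i * u) ^ (-α) := by
        refine ENNReal.toReal_le_of_le_ofReal (by positivity) ?_
        refine (measure_mono fun θ hθ => ?_).trans (hm i hi (r i * u) (by positivity))
        exact lt_of_lt_of_le (mem_Ioi.1 hθ) (le_abs_self θ)
      have h2 : r i ^ α * (C * (r i * u) ^ (-α)) = C * u ^ (-α) := by
        rw [Real.mul_rpow hri.le hu0.le, Real.rpow_neg hri.le]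
        field_simp
      have h3 := hg0 u
      rw [Real.norm_of_nonneg (by positivity)]
      calc r i ^ α * (m i).real (Ioi (r i * u)) * g u
          ≤ r i ^ α * (C * (r i * u) ^ (-α)) * g u := by gcongr
        _ = _ := by rw [h2, hg]; ring
    · exact (integrableOn_abs_one_add_rpow_sub_one_mul hα1 hα2 (by linarith)
        (by linarith)).const_mul _
    · filter_upwards [ae_restrict_mem measurableSet_Ioi] with u hu
      have hu0 : (0 : ℝ) < u := hu
      refine Tendsto.mul_const _ ?_
      have h1 : Tendsto (fun i => (r i * u) ^ α * (m i).real (Ioi (r i * u))) l (𝓝 c) := by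
        rw [Metric.tendsto_nhds]
        intro ε hε
        have h2 := Metric.tendstoUniformlyOn_iff.1 h.right ε hε
        filter_upwards [(hr.atTop_mul_const hu0).eventually h2, hS] with i hi1 hi
        rw [dist_comm]
        exact hi1 i hi
      refine (h1.mul_const (u ^ (-α))).congr' ?_
      filter_upwards [hr.eventually_gt_atTop 0] with i hri
      rw [Real.mul_rpow hri.le hu0.le, Real.rpow_neg hu0.le]
      field_simp
  -- A common sign, `1` if `ν ≥ 1` and `-1` if `ν ≤ 1`, removes the absolute values from both the
  -- remainder and its derivative.
  obtain ⟨σ, hσ1, hσ2⟩ : ∃ σ : ℝ, (∀ v, 0 ≤ v → (1 + v) ^ ν - 1 - ν * v =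
      σ * |(1 + v) ^ ν - 1 - ν * v|) ∧ ∀ v, 0 ≤ v → (1 + v) ^ (ν - 1) - 1 =
      σ * |(1 + v) ^ (ν - 1) - 1| := by
    rcases le_total 1 ν with h1 | h1
    · refine ⟨1, fun v hv => ?_, fun v hv => ?_⟩
      · have := one_add_mul_self_le_rpow_one_add (s := v) (by linarith) h1
        rw [one_mul, abs_of_nonneg]
        linarith
      · have := Real.one_le_rpow (x := 1 + v) (by linarith) (by linarith : 0 ≤ ν - 1)
        rw [one_mul, abs_of_nonneg]
        linarith
    · refine ⟨-1, fun v hv => ?_, fun v hv => ?_⟩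
      · have := rpow_one_add_le_one_add_mul_self (s := v) (by linarith) hν.le h1
        rw [abs_of_nonpos (by linarith)]
        ring
      · have := Real.rpow_le_one_of_one_le_of_nonpos (x := 1 + v) (by linarith)
          (by linarith : ν - 1 ≤ 0)
        rw [abs_of_nonpos (by linarith)]
        ring
  have hval : σ * ∫ u in Ioi (0 : ℝ), c * u ^ (-α) * g u = c * (ν * jumpIntegral α ν) := by
    rw [jumpIntegral, ← integral_const_mul, ← integral_const_mul, ← integral_const_mul]
    refine setIntegral_congr_fun measurableSet_Ioi fun u hu => ?_
    have hu0 : (0 : ℝ) < u := hu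
    simp only [hg]
    conv_rhs => rw [hσ2 u hu0.le]
    ring
  rw [← hval]
  refine (hlim.const_mul σ).congr' ?_
  filter_upwards [hr.eventually_gt_atTop 0, hS] with i hri hi
  rw [← hrep i hi hri, mul_left_comm, ← integral_const_mul]
  congr 1
  refine integral_congr_ae (Eventually.of_forall fun θ => ?_)
  exact (hσ1 _ (by positivity)).symm

lemma integral_one_add_add_add {Ω : Type*} [MeasurableSpace Ω] {μ : Measure Ω}
    [IsProbabilityMeasure μ] {f g k : Ω → ℝ} (hf : Integrable f μ) (hg : Integrable g μ)
    (hk : Integrable k μ) :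
    ∫ ω, (1 + f ω + g ω + k ω) ∂μ = 1 + ∫ ω, f ω ∂μ + ∫ ω, g ω ∂μ + ∫ ω, k ω ∂μ := by
  have h1 : Integrable (fun ω => 1 + f ω) μ := (integrable_const _).add hf
  have h2 : Integrable (fun ω => 1 + f ω + g ω) μ := h1.add hg
  rw [integral_add h2 hk, integral_add h1 hg, integral_add (integrable_const _) hf]
  simp

lemma HeavyRightTail.tendsto_integral_neg_part (h : HeavyRightTail m S α β c) {l : Filter ι}
    {r : ι → ℝ} (hr : Tendsto r l atTop) (hS : ∀ᶠ i in l, i ∈ S) {ν : ℝ}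
    (hν : 0 < ν) (hνα : ν < α) :
    (∀ᶠ i in l, Integrable (fun θ => |1 - max (-θ) 0 / r i| ^ ν - 1 + ν * (max (-θ) 0 / r i))
      (m i)) ∧
    Tendsto (fun i => r i ^ α *
      ∫ θ, (|1 - max (-θ) 0 / r i| ^ ν - 1 + ν * (max (-θ) 0 / r i)) ∂m i) l (𝓝 0) := by
  obtain ⟨M, hM0, hM⟩ := h.left
  have hα1 := h.one_lt_alpha
  -- A moment of order `κ > α` makes the inward remainder `O(r ^ (-κ))`, negligible against `r ^
  -- (-α)`; `κ ≤ 2` is imposed by the Taylor bound.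
  set κ := min β 2 with hκ
  have hακ : α < κ := lt_min h.alpha_lt_beta h.alpha_lt_two
  have hκβ : κ ≤ β := min_le_left _ _
  obtain ⟨K, hK0, hK⟩ := abs_one_sub_rpow_le hν (by linarith : ν ≤ κ) (by linarith)
    (min_le_right β 2)
  have hmom : ∀ i ∈ S, ∫⁻ θ, ENNReal.ofReal (max (-θ) 0 ^ κ) ∂m i ≤ ENNReal.ofReal (1 + M) := by
    intro i hi
    have := h.prob i
    calc ∫⁻ θ, ENNReal.ofReal (max (-θ) 0 ^ κ) ∂m i
        ≤ ∫⁻ θ, (1 + ENNReal.ofReal (max (-θ) 0 ^ β)) ∂m i := by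
          refine lintegral_mono fun θ => ?_
          have h0 : 0 ≤ max (-θ) 0 := le_max_right _ _
          rw [← ENNReal.ofReal_one, ← ENNReal.ofReal_add zero_le_one (by positivity)]
          refine ENNReal.ofReal_le_ofReal ?_
          have h2 : 0 ≤ max (-θ) 0 ^ β := by positivity
          rcases le_total (max (-θ) 0) 1 with h1 | h1
          · have := Real.rpow_le_one h0 h1 (by linarith : 0 ≤ κ)
            linarith
          · have := Real.rpow_le_rpow_of_exponent_le h1 hκβ
            linarith
      _ = 1 + ∫⁻ θ, ENNReal.ofReal (max (-θ) 0 ^ β) ∂m i := by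
          rw [lintegral_add_left measurable_const]; simp
      _ ≤ 1 + ENNReal.ofReal M := by gcongr; exact hM i hi
      _ = ENNReal.ofReal (1 + M) := by rw [ENNReal.ofReal_add zero_le_one hM0]; simp
  have hI : ∀ i ∈ S, Integrable (fun θ => max (-θ) 0 ^ κ) (m i) := fun i hi => by
    refine ⟨Measurable.aestronglyMeasurable (by fun_prop), ?_⟩
    rw [hasFiniteIntegral_iff_ofReal (f := fun θ => max (-θ) 0 ^ κ)
      (Eventually.of_forall fun θ => by simp only [Pi.zero_apply]; positivity)]
    exact (hmom i hi).trans_lt ENNReal.ofReal_lt_top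
  have hI2 : ∀ i ∈ S, ∫ θ, max (-θ) 0 ^ κ ∂m i ≤ 1 + M := fun i hi => by
    rw [integral_eq_lintegral_of_nonneg_ae
      (Eventually.of_forall fun θ => by simp only [Pi.zero_apply]; positivity)
      (Measurable.aestronglyMeasurable (by fun_prop))]
    exact ENNReal.toReal_le_of_le_ofReal (by linarith) (hmom i hi)
  have hbound : ∀ i, 0 < r i → ∀ θ : ℝ,
      ‖|1 - max (-θ) 0 / r i| ^ ν - 1 + ν * (max (-θ) 0 / r i)‖ ≤
        K * r i ^ (-κ) * max (-θ) 0 ^ κ := by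
    intro i hri θ
    refine (hK _ (by positivity)).trans (le_of_eq ?_)
    rw [Real.div_rpow (le_max_right _ _) hri.le, Real.rpow_neg hri.le]
    ring
  refine ⟨?_, ?_⟩
  · filter_upwards [hr.eventually_gt_atTop 0, hS] with i hri hi
    exact ((hI i hi).const_mul (K * r i ^ (-κ))).mono'
      (Measurable.aestronglyMeasurable (by fun_prop)) (Eventually.of_forall (hbound i hri))
  · have h0 : Tendsto (fun i => K * (1 + M) * r i ^ (-(κ - α))) l (𝓝 0) := by
      have := ((tendsto_rpow_neg_atTop (by linarith : 0 < κ - α)).comp hr).const_mul (K * (1 + M))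
      rwa [mul_zero] at this
    refine squeeze_zero_norm' ?_ h0
    filter_upwards [hr.eventually_gt_atTop 0, hS] with i hri hi
    rw [norm_mul, Real.norm_of_nonneg (by positivity : 0 ≤ r i ^ α)]
    calc r i ^ α * ‖∫ θ, (|1 - max (-θ) 0 / r i| ^ ν - 1 + ν * (max (-θ) 0 / r i)) ∂m i‖
        ≤ r i ^ α * ∫ θ, K * r i ^ (-κ) * max (-θ) 0 ^ κ ∂m i := by
          gcongr
          exact norm_integral_le_of_norm_le ((hI i hi).const_mul _)
            (Eventually.of_forall (hbound i hri))
      _ ≤ r i ^ α * (K * r i ^ (-κ) * (1 + M)) := by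
          rw [integral_const_mul]
          gcongr
          exact hI2 i hi
      _ = _ := by
          rw [show -(κ - α) = α + -κ by ring, Real.rpow_add hri]
          ring

/-- First order expansion of the mean increment of a power of the distance to the origin. -/
lemma HeavyRightTail.tendsto_rpow_increment (h : HeavyRightTail m S α β c) {l : Filter ι}
    [l.IsCountablyGenerated] {r : ι → ℝ} (hr : Tendsto r l atTop) (hS : ∀ᶠ i in l, i ∈ S) {ν : ℝ}
    (hν : 0 < ν) (hνα : ν < α) :
    Tendsto (fun i => r i ^ (α - ν) * (∫ θ, |r i + θ| ^ ν ∂m i - r i ^ ν) -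
      ν * (r i ^ (α - 1) * ∫ θ, θ ∂m i)) l (𝓝 (c * (ν * jumpIntegral α ν))) := by
  obtain ⟨C, hC, hm⟩ := h.exists_hasTailBound
  obtain ⟨hnegI, hneg⟩ := h.tendsto_integral_neg_part hr hS hν hνα
  have hpos := h.tendsto_integral_pos_part hr hS hν hνα
  have hsum := hpos.add hneg
  rw [add_zero] at hsum
  refine hsum.congr' ?_
  filter_upwards [hr.eventually_gt_atTop 0, hS, hnegI] with i hri hi hni
  have := h.prob i
  have hpi := hm.integrable_pos_part h.one_lt_alpha hν hνα hC hi hri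
  have hid := hm.integrable_id h.one_lt_alpha hC hi
  -- Only one of `θ₊`, `θ₋` is nonzero, so the two remainders decouple, and their linear parts
  -- combine into `ν / r * θ`.
  have hpt : ∀ θ : ℝ, |r i + θ| ^ ν = r i ^ ν * (1 + ((1 + max θ 0 / r i) ^ ν - 1 -
      ν * (max θ 0 / r i)) + (|1 - max (-θ) 0 / r i| ^ ν - 1 + ν * (max (-θ) 0 / r i)) +
      ν / r i * θ) := by
    intro θ
    rcases le_total 0 θ with h0 | h0
    · rw [max_eq_left h0, max_eq_right (by linarith), abs_of_nonneg (by linarith),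
        show r i + θ = r i * (1 + θ / r i) by field_simp,
        Real.mul_rpow hri.le (by positivity)]
      simp only [zero_div, sub_zero, abs_one, Real.one_rpow, sub_self, mul_zero, add_zero]
      ring
    · rw [max_eq_right h0, max_eq_left (by linarith),
        show r i + θ = r i * (1 - -θ / r i) by field_simp; ring, abs_mul, abs_of_pos hri,
        Real.mul_rpow hri.le (abs_nonneg _)]
      simp only [zero_div, Real.one_rpow, sub_self, mul_zero, add_zero]
      ring
  simp_rw [hpt]
  rw [integral_const_mul, integral_one_add_add_add hpi hni (hid.const_mul _), integral_const_mul]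
  generalize ∫ θ, ((1 + max θ 0 / r i) ^ ν - 1 - ν * (max θ 0 / r i)) ∂m i = A
  generalize ∫ θ, (|1 - max (-θ) 0 / r i| ^ ν - 1 + ν * (max (-θ) 0 / r i)) ∂m i = B
  rw [Real.rpow_sub hri, Real.rpow_sub hri, Real.rpow_one]
  field_simp
  ring

end PowerIncrement

/-! ### Reflection of the two half-lines onto the distance to the origin -/

section OutwardLaw

variable {X : Set ℝ}

/-- The displacement from `x` to `z`, counted positively when it points away from the origin. -/
def outward (x z : X) : ℝ := if 0 ≤ (x : ℝ) then (z : ℝ) - x else x - z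

lemma measurable_outward (x : X) : Measurable (outward x) := by
  unfold outward
  split_ifs <;> fun_prop

/-- Lyapunov functions of `|z|` therefore see only the outward law, and both half-lines are treated
at once. -/
lemma abs_abs_add_outward (x z : X) : |(|(x : ℝ)| + outward x z)| = |(z : ℝ)| := by
  unfold outward
  split_ifs with h
  · rw [abs_of_nonneg h]; congr 1; ring
  · rw [abs_of_neg (not_le.1 h), ← abs_neg]; congr 1; ring

/-- The law of the outward displacement from `x`. -/
def outwardLaw (P : Kernel X X) (x : X) : Measure ℝ := (P x).map (outward x)

variable {P : Kernel X X}

lemma lintegral_outwardLaw (x : X) {f : ℝ → ℝ≥0∞} (hf : Measurable f) :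
    ∫⁻ θ, f θ ∂outwardLaw P x = ∫⁻ z, f (outward x z) ∂P x :=
  lintegral_map hf (measurable_outward x)

lemma integral_outwardLaw_comp (x : X) {f : ℝ → ℝ} (hf : Measurable f) :
    ∫ θ, f |(|(x : ℝ)| + θ)| ∂outwardLaw P x = ∫ z : X, f |(z : ℝ)| ∂P x := by
  rw [outwardLaw, integral_map (measurable_outward x).aemeasurable
    (Measurable.aestronglyMeasurable (by fun_prop))]
  simp_rw [abs_abs_add_outward]

lemma integrable_outwardLaw_comp_iff (x : X) {f : ℝ → ℝ} (hf : Measurable f) :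
    Integrable (fun θ => f |(|(x : ℝ)| + θ)|) (outwardLaw P x) ↔
      Integrable (fun z : X => f |(z : ℝ)|) (P x) := by
  rw [outwardLaw, integrable_map_measure (Measurable.aestronglyMeasurable (by fun_prop))
    (measurable_outward x).aemeasurable]
  simp [Function.comp_def, abs_abs_add_outward]

lemma integral_outwardLaw_id (x : X) :
    ∫ θ, θ ∂outwardLaw P x = if 0 ≤ (x : ℝ) then drift P x else -drift P x := by
  rw [outwardLaw, integral_map (measurable_outward x).aemeasurable
    (Measurable.aestronglyMeasurable (by fun_prop)), drift]
  by_cases h : 0 ≤ (x : ℝ)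
  · simp [outward, h]
  · rw [if_neg h, ← integral_neg]
    simp [outward, h]

lemma outwardLaw_real_Ioi [IsMarkovKernel P] (x : X) {y : ℝ} (hy : 0 ≤ y) :
    (outwardLaw P x).real (Ioi y) =
      if 0 ≤ (x : ℝ) then (P x).real {z : X | y < max ((z : ℝ) - (x : ℝ)) 0}
      else (P x).real {z : X | y < max ((x : ℝ) - (z : ℝ)) 0} := by
  rw [outwardLaw, map_measureReal_apply (measurable_outward x) measurableSet_Ioi]
  by_cases h : 0 ≤ (x : ℝ)
  · rw [if_pos h]
    congr 1
    ext z
    simp [outward, h, not_lt.2 hy]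
  · rw [if_neg h]
    congr 1
    ext z
    simp [outward, h, not_lt.2 hy]

lemma OutwardTails.heavyRightTail [IsMarkovKernel P] {α β c x₀ : ℝ}
    (hT : OutwardTails P α β c x₀) :
    HeavyRightTail (outwardLaw P) {x : X | x₀ ≤ |(x : ℝ)|} α β c where
  prob x := Measure.isProbabilityMeasure_map (measurable_outward x).aemeasurable
  one_lt_alpha := hT.one_lt_alpha
  alpha_lt_two := hT.alpha_lt_two
  alpha_lt_beta := hT.alpha_lt_beta
  c_pos := hT.c_pos
  right := by
    rw [Metric.tendstoUniformlyOn_iff]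
    intro ε hε
    filter_upwards [Metric.tendstoUniformlyOn_iff.1 hT.right_outward ε hε,
      Metric.tendstoUniformlyOn_iff.1 hT.left_outward ε hε, eventually_ge_atTop 0] with y h1 h2 hy x hx
    replace hx : x₀ ≤ |(x : ℝ)| := hx
    rw [outwardLaw_real_Ioi x hy]
    by_cases h : 0 ≤ (x : ℝ)
    · rw [if_pos h]
      rw [abs_of_nonneg h] at hx
      exact h1 x hx
    · rw [if_neg h]
      rw [abs_of_neg (not_le.1 h)] at hx
      exact h2 x (by linarith : (x : ℝ) ≤ -x₀)
  left := by
    have h1 := hT.right_inward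
    have h2 := hT.left_inward
    set M₁ := ⨆ (x : X) (_ : x₀ ≤ (x : ℝ)),
      ∫⁻ z : X, ENNReal.ofReal (max ((x : ℝ) - (z : ℝ)) 0 ^ β) ∂(P x) with hM₁
    set M₂ := ⨆ (x : X) (_ : (x : ℝ) ≤ -x₀),
      ∫⁻ z : X, ENNReal.ofReal (max ((z : ℝ) - (x : ℝ)) 0 ^ β) ∂(P x) with hM₂
    refine ⟨(M₁ + M₂).toReal, ENNReal.toReal_nonneg, fun x hx => ?_⟩
    replace hx : x₀ ≤ |(x : ℝ)| := hx
    rw [ENNReal.ofReal_toReal (ENNReal.add_lt_top.2 ⟨h1, h2⟩).ne,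
      lintegral_outwardLaw x (by fun_prop)]
    by_cases h : 0 ≤ (x : ℝ)
    · rw [abs_of_nonneg h] at hx
      refine le_trans (le_trans (le_of_eq ?_) (le_iSup₂ (f := fun (x : X) (_ : x₀ ≤ (x : ℝ)) =>
        ∫⁻ z : X, ENNReal.ofReal (max ((x : ℝ) - (z : ℝ)) 0 ^ β) ∂(P x)) x hx)) le_self_add
      simp [outward, h]
    · rw [abs_of_neg (not_le.1 h)] at hx
      refine le_trans (le_trans (le_of_eq ?_) (le_iSup₂ (f := fun (x : X) (_ : (x : ℝ) ≤ -x₀) =>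
        ∫⁻ z : X, ENNReal.ofReal (max ((z : ℝ) - (x : ℝ)) 0 ^ β) ∂(P x)) x (by linarith)))
        le_add_self
      simp [outward, h]

variable (X) in
/-- The neighbourhood filter of infinity on `X`. -/
def atInfinity : Filter X := comap (fun x : X => |(x : ℝ)|) atTop

instance isCountablyGenerated_atInfinity : (atInfinity X).IsCountablyGenerated := by
  unfold atInfinity; infer_instance

lemma tendsto_abs_atInfinity : Tendsto (fun x : X => |(x : ℝ)|) (atInfinity X) atTop :=
  tendsto_comap

lemma eventually_forall_lt_abs {p : X → Prop} (h : ∀ᶠ x in atInfinity X, p x) :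
    ∀ᶠ a : ℝ in atTop, ∀ x : X, a < |(x : ℝ)| → p x := by
  obtain ⟨A, hA⟩ := eventually_atTop.1 (eventually_comap.1 h)
  filter_upwards [eventually_ge_atTop A] with a ha x hx
  exact hA _ (ha.trans hx.le) x rfl

lemma atInfinity_eq : atInfinity X =
    comap (fun x : X => (x : ℝ)) atBot ⊔ comap (fun x : X => (x : ℝ)) atTop := by
  rw [← comap_sup, ← comap_abs_atTop, comap_comap]
  rfl

lemma DriftAsymptotics.tendsto_outwardLaw {γ b : ℝ} (hD : DriftAsymptotics P γ b) :
    Tendsto (fun x : X => |(x : ℝ)| ^ γ * ∫ θ, θ ∂outwardLaw P x) (atInfinity X) (𝓝 b) := by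
  rw [atInfinity_eq]
  refine Tendsto.sup ?_ ?_
  · refine hD.left.congr' ?_
    filter_upwards [tendsto_comap.eventually (eventually_lt_atBot (0 : ℝ))] with x hx
    rw [integral_outwardLaw_id, if_neg (not_le.2 hx)]
    ring
  · refine hD.right.congr' ?_
    filter_upwards [tendsto_comap.eventually (eventually_ge_atTop (0 : ℝ))] with x hx
    rw [integral_outwardLaw_id, if_pos hx, abs_of_nonneg hx]

end OutwardLaw

/-! ### Survival from far away -/

section Staying

/-- A smooth cutoff equal to one on `[-1, 1]` and to zero off `[-2, 2]`. -/
def cutoff : ContDiffBump (0 : ℝ) := ⟨1, 2, one_pos, one_lt_two⟩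

lemma cutoff_abs (t : ℝ) : cutoff |t| = cutoff t := by
  rcases abs_choice t with h | h <;> rw [h]
  exact cutoff.neg t

lemma cutoff_eq_one {t : ℝ} (ht : |t| ≤ 1) : cutoff t = 1 :=
  cutoff.one_of_mem_closedBall (by simpa [Real.dist_eq, cutoff] using ht)

lemma cutoff_eq_zero {t : ℝ} (ht : 2 ≤ |t|) : cutoff t = 0 :=
  cutoff.zero_of_le_dist (by simpa [Real.dist_eq, cutoff] using ht)

lemma deriv_cutoff_eq_zero {t : ℝ} (ht : |t| < 1) : deriv cutoff t = 0 := by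
  have : cutoff =ᶠ[𝓝 t] fun _ => 1 := by
    filter_upwards [(isOpen_lt continuous_abs continuous_const).mem_nhds ht] with u hu
    exact cutoff_eq_one (le_of_lt hu)
  rw [this.deriv_eq, deriv_const]

lemma exists_cutoff_bounds : ∃ K : ℝ, 0 ≤ K ∧ (∀ t, |deriv cutoff t| ≤ K) ∧
    ∀ t h, |cutoff (t + h) - cutoff t - deriv cutoff t * h| ≤ K * min (|h| ^ 2) |h| := by
  have hsm : ContDiff ℝ 2 (cutoff : ℝ → ℝ) := cutoff.contDiff
  have hd : ContDiff ℝ 1 (deriv (cutoff : ℝ → ℝ)) := hsm.deriv' (n := 1)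
  have hcs : HasCompactSupport (cutoff : ℝ → ℝ) := cutoff.hasCompactSupport
  obtain ⟨K₁, hK₁⟩ := hd.continuous.bounded_above_of_compact_support hcs.deriv
  obtain ⟨K₂, hK₂⟩ := (hd.continuous_deriv le_rfl).bounded_above_of_compact_support hcs.deriv.deriv
  have hK₁0 : 0 ≤ K₁ := (norm_nonneg _).trans (hK₁ 0)
  have hK₂0 : 0 ≤ K₂ := (norm_nonneg _).trans (hK₂ 0)
  refine ⟨2 * K₁ + K₂, by positivity, fun t => ?_, fun t h => ?_⟩
  · have := hK₁ t
    rw [Real.norm_eq_abs] at this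
    linarith
  · have hdiff : Differentiable ℝ (cutoff : ℝ → ℝ) := hsm.differentiable (by norm_num)
    have hdd : Differentiable ℝ (deriv (cutoff : ℝ → ℝ)) := hd.differentiable (by norm_num)
    have hlip : ∀ u v, |deriv cutoff u - deriv cutoff v| ≤ K₂ * |u - v| := fun u v => by
      have := convex_univ.norm_image_sub_le_of_norm_deriv_le (f := deriv (cutoff : ℝ → ℝ))
        (fun w _ => hdd w) (fun w _ => hK₂ w) (mem_univ v) (mem_univ u)
      simpa [Real.norm_eq_abs] using this
    -- Mean value inequality for the cutoff minus its tangent line; `B = K₂ |h|` yields the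
    -- quadratic bound and `B = 2 K₁` the linear one.
    have key : ∀ B : ℝ, (∀ u ∈ uIcc t (t + h), |deriv cutoff u - deriv cutoff t| ≤ B) →
        |cutoff (t + h) - cutoff t - deriv cutoff t * h| ≤ B * |h| := by
      intro B hB
      have hder : ∀ u ∈ uIcc t (t + h), HasDerivWithinAt
          (fun u => cutoff u - deriv cutoff t * u) (deriv cutoff u - deriv cutoff t)
          (uIcc t (t + h)) u := fun u _ => by
        have := (hdiff u).hasDerivAt.sub ((hasDerivAt_id u).const_mul (deriv cutoff t))
        rw [mul_one] at this
        exact this.hasDerivWithinAt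
      have := (convex_uIcc t (t + h)).norm_image_sub_le_of_norm_hasDerivWithin_le hder
        (C := B) (fun u hu => hB u hu) left_mem_uIcc right_mem_uIcc
      rw [add_sub_cancel_left, Real.norm_eq_abs, Real.norm_eq_abs] at this
      refine le_trans (le_of_eq ?_) this
      congr 1
      ring
    have h1 := key (K₂ * |h|) fun u hu => (hlip u t).trans (by
      have := abs_sub_left_of_mem_uIcc hu
      rw [add_sub_cancel_left] at this
      gcongr)
    have h2 := key (2 * K₁) fun u _ => by
      have h3 := hK₁ u
      have h4 := hK₁ t
      rw [Real.norm_eq_abs] at h3 h4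
      exact (abs_sub _ _).trans (by linarith)
    have h0 := abs_nonneg h
    rw [mul_min_of_nonneg _ _ (by positivity)]
    refine le_min (h1.trans ?_) (h2.trans ?_) <;> nlinarith

variable {X : Set ℝ} {P : Kernel X X} [IsMarkovKernel P]

/-- Started far from the origin at distance of order `y`, the chain survives for a time of order
`y ^ (1 + γ)`. -/
lemma exists_le_survival_of_far {α β c x₀ γ B a₁ : ℝ} (hT : OutwardTails P α β c x₀)
    (hγ : 0 ≤ γ) (hγα : γ ≤ α - 1) (hB : 0 ≤ B) (ha₁ : x₀ ≤ a₁)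
    (hdrift : ∀ x : X, a₁ < |(x : ℝ)| → |∫ θ, θ ∂outwardLaw P x| ≤ B * |(x : ℝ)| ^ (-γ)) :
    ∃ C : ℝ, 0 < C ∧ ∀ a y : ℝ, a₁ ≤ a → a ≤ y → 1 ≤ y → ∀ x : X, 2 * y ≤ |(x : ℝ)| → ∀ n : ℕ,
      1 - n * (C * y ^ (-(1 + γ))) ≤ survival P a n x := by
  have h := hT.heavyRightTail
  obtain ⟨C₀, hC₀, hm⟩ := h.exists_hasTailBound
  obtain ⟨K', hK'0, hK'⟩ := hm.exists_lintegral_min_le h.one_lt_alpha h.alpha_lt_two hC₀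
  obtain ⟨K, hK0, hK1, hK2⟩ := exists_cutoff_bounds
  refine ⟨K * B + K * K' + 1, by positivity, fun a y haa hay hy x hx n => ?_⟩
  have hy0 : 0 < y := by linarith
  set e := (K * B + K * K' + 1) * y ^ (-(1 + γ)) with he
  have he0 : 0 ≤ e := by positivity
  have hcm : Measurable (cutoff : ℝ → ℝ) := cutoff.continuous.measurable
  have hdm : Measurable fun t : ℝ => cutoff (t / y) := hcm.comp (measurable_id.div_const y)
  have hint : ∀ x : X, Integrable (fun z : X => cutoff (|(z : ℝ)| / y)) (P x) := fun x => by
    refine Integrable.of_bound (C := 1)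
      (hdm.comp measurable_subtype_coe.abs).aestronglyMeasurable (Eventually.of_forall fun z => ?_)
    rw [Real.norm_of_nonneg cutoff.nonneg]
    exact cutoff.le_one
  -- The cutoff at scale `y` is `1` on `[-a, a]`, as `a ≤ y`, and `0` at the starting point. Its
  -- mean growth per step has a drift part and a truncated quadratic part, both of order at most `y
  -- ^ (-(1 + γ))`.
  have hsup : ∀ x : X, a < |(x : ℝ)| → ∫ z : X, cutoff (|(z : ℝ)| / y) ∂P x ≤
      cutoff (|(x : ℝ)| / y) + e := by
    intro x hx
    have hxS : x ∈ {x : X | x₀ ≤ |(x : ℝ)|} := show x₀ ≤ |(x : ℝ)| by linarith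
    have := h.prob x
    have hid := hm.integrable_id h.one_lt_alpha hC₀ hxS
    set r := |(x : ℝ)| with hr
    have hr0 : 0 ≤ r := abs_nonneg _
    have hlow : Integrable (fun θ : ℝ => min ((|θ| / y) ^ 2) (|θ| / y)) (outwardLaw P x) := by
      refine (hid.abs.div_const y).mono' (Measurable.aestronglyMeasurable (by fun_prop))
        (Eventually.of_forall fun θ => ?_)
      rw [Real.norm_of_nonneg (by positivity)]
      exact min_le_right _ _
    have hmin : ∫ θ, min ((|θ| / y) ^ 2) (|θ| / y) ∂outwardLaw P x ≤ K' * y ^ (-α) := by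
      rw [integral_eq_lintegral_of_nonneg_ae (Eventually.of_forall fun θ => by
        simp only [Pi.zero_apply]; positivity) (Measurable.aestronglyMeasurable (by fun_prop))]
      exact ENNReal.toReal_le_of_le_ofReal (by positivity) (hK' x hxS y hy0)
    have hIc := (integrable_outwardLaw_comp_iff (P := P) x (f := fun t => cutoff (t / y)) hdm).2
      (hint x)
    have h1 : ∫ z : X, cutoff (|(z : ℝ)| / y) ∂P x ≤
        ∫ θ, (cutoff (r / y) + deriv cutoff (r / y) / y * θ +
          K * min ((|θ| / y) ^ 2) (|θ| / y)) ∂outwardLaw P x := by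
      rw [← integral_outwardLaw_comp (P := P) x (f := fun t => cutoff (t / y)) hdm]
      refine integral_mono hIc
        (((integrable_const _).add (hid.const_mul _)).add (hlow.const_mul K)) fun θ => ?_
      have h2 := hK2 (r / y) (θ / y)
      rw [abs_div θ y, abs_of_pos hy0] at h2
      have h3 : cutoff (|r + θ| / y) = cutoff (r / y + θ / y) := by
        rw [← add_div, ← cutoff_abs ((r + θ) / y), abs_div, abs_of_pos hy0]
      have h4 := (abs_le.1 h2).2
      simp only [← hr]
      rw [h3]
      have h5 : deriv cutoff (r / y) / y * θ = deriv cutoff (r / y) * (θ / y) := by ring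
      linarith
    have hsplit : ∫ θ, (cutoff (r / y) + deriv cutoff (r / y) / y * θ +
          K * min ((|θ| / y) ^ 2) (|θ| / y)) ∂outwardLaw P x =
        cutoff (r / y) + deriv cutoff (r / y) / y * ∫ θ, θ ∂outwardLaw P x +
          K * ∫ θ, min ((|θ| / y) ^ 2) (|θ| / y) ∂outwardLaw P x := by
      have hi1 : Integrable (fun θ : ℝ => cutoff (r / y) + deriv cutoff (r / y) / y * θ)
        (outwardLaw P x) := (integrable_const _).add (hid.const_mul _)
      rw [integral_add hi1 (hlow.const_mul K), integral_add (integrable_const _) (hid.const_mul _),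
        integral_const_mul, integral_const_mul]
      simp
    -- Inside distance `y` the cutoff is flat, so the drift matters only for `r ≥ y`, where it is at
    -- most `B y ^ (-γ)`.
    have hdr : deriv cutoff (r / y) / y * ∫ θ, θ ∂outwardLaw P x ≤ K * B * y ^ (-(1 + γ)) := by
      rcases lt_or_ge r y with hry | hry
      · rw [deriv_cutoff_eq_zero (by rw [abs_of_nonneg (by positivity), div_lt_one hy0]; exact hry)]
        simp only [zero_div, zero_mul]
        positivity
      · have hr1 : 0 < r := by linarith
        calc deriv cutoff (r / y) / y * ∫ θ, θ ∂outwardLaw P x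
            ≤ |deriv cutoff (r / y) / y * ∫ θ, θ ∂outwardLaw P x| := le_abs_self _
          _ = |deriv cutoff (r / y)| / y * |∫ θ, θ ∂outwardLaw P x| := by
              rw [abs_mul, abs_div, abs_of_pos hy0]
          _ ≤ K / y * (B * y ^ (-γ)) := by
              gcongr
              · exact hK1 _
              · refine (hdrift x (by linarith)).trans ?_
                gcongr ?_ * ?_
                exact Real.rpow_le_rpow_of_nonpos hy0 hry (by linarith)
          _ = K * B * y ^ (-(1 + γ)) := by
              rw [neg_add, Real.rpow_add hy0, Real.rpow_neg_one]; ring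
    -- `y ^ (-α) ≤ y ^ (-(1 + γ))` because `γ ≤ α - 1` and `y ≥ 1`.
    have hmin2 : K * ∫ θ, min ((|θ| / y) ^ 2) (|θ| / y) ∂outwardLaw P x ≤
        K * K' * y ^ (-(1 + γ)) := by
      rw [mul_assoc]
      refine mul_le_mul_of_nonneg_left (hmin.trans ?_) hK0
      gcongr
      linarith
    have hy1 : 0 ≤ y ^ (-(1 + γ)) := by positivity
    rw [hsplit] at h1
    rw [he]
    linarith
  have := one_sub_survival_le (P := P) (a := a) (D := fun z : X => cutoff (|(z : ℝ)| / y)) (e := e)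
    (fun z => cutoff.nonneg) (fun z hz => by
      rw [cutoff_eq_one]
      rw [abs_of_nonneg (by positivity), div_le_one hy0]
      linarith) he0 (fun z _ => hint z) hsup n x
  rw [cutoff_eq_zero (by rw [abs_of_nonneg (by positivity), le_div_iff₀ hy0]; exact hx)] at this
  linarith

end Staying

/-! ### Tail bounds for the passage time in the different drift regimes -/

section PassageMoments

variable {X : Set ℝ} {P : Kernel X X}

lemma DriftAsymptotics.of_lt {γ γ' b : ℝ} (hD : DriftAsymptotics P γ b) (hγ' : 0 ≤ γ')
    (h : γ' < γ) : DriftAsymptotics P γ' 0 where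
  gamma_nonneg := hγ'
  right := by
    have h1 : Tendsto (fun x : X => (x : ℝ) ^ (-(γ - γ'))) (comap (fun x : X => (x : ℝ)) atTop)
        (𝓝 0) := (tendsto_rpow_neg_atTop (by linarith)).comp tendsto_comap
    have h2 := h1.mul hD.right
    rw [zero_mul] at h2
    refine h2.congr' ?_
    filter_upwards [tendsto_comap.eventually (eventually_gt_atTop (0 : ℝ))] with x hx
    rw [← mul_assoc, ← Real.rpow_add hx]
    congr 2
    ring
  left := by
    have h0 : Tendsto (fun x : X => |(x : ℝ)|) (comap (fun x : X => (x : ℝ)) atBot) atTop :=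
      tendsto_abs_atBot_atTop.comp tendsto_comap
    have h1 : Tendsto (fun x : X => |(x : ℝ)| ^ (-(γ - γ')))
        (comap (fun x : X => (x : ℝ)) atBot) (𝓝 0) :=
      (tendsto_rpow_neg_atTop (by linarith)).comp h0
    have h2 := h1.mul hD.left
    rw [zero_mul] at h2
    refine h2.congr' ?_
    filter_upwards [h0.eventually_gt_atTop 0] with x hx
    rw [mul_neg, ← mul_assoc, ← Real.rpow_add hx]
    congr 3
    ring

variable [IsMarkovKernel P] {α β c x₀ γ b : ℝ}

lemma eventually_atInfinity_mem (x₀ : ℝ) :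
    ∀ᶠ x in atInfinity X, x ∈ {x : X | x₀ ≤ |(x : ℝ)|} :=
  tendsto_abs_atInfinity.eventually_ge_atTop x₀

lemma OutwardTails.tendsto_power_increment (hT : OutwardTails P α β c x₀) {ν : ℝ} (hν : 0 < ν)
    (hνα : ν < α) :
    Tendsto (fun x : X => |(x : ℝ)| ^ (α - ν) * (∫ z : X, |(z : ℝ)| ^ ν ∂P x - |(x : ℝ)| ^ ν) -
      ν * (|(x : ℝ)| ^ (α - 1) * ∫ θ, θ ∂outwardLaw P x)) (atInfinity X)
      (𝓝 (c * (ν * jumpIntegral α ν))) := by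
  have h := hT.heavyRightTail.tendsto_rpow_increment tendsto_abs_atInfinity
    (eventually_atInfinity_mem x₀) hν hνα
  refine h.congr fun x => ?_
  rw [integral_outwardLaw_comp x (f := fun t => t ^ ν) (by fun_prop)]

/-- At the critical drift order both effects have size `r ^ (ν - α)`; the sign of the limit changes
exactly at the critical exponent. -/
lemma OutwardTails.tendsto_power_increment_critical (hT : OutwardTails P α β c x₀)
    (hD : DriftAsymptotics P (α - 1) b) {ν : ℝ} (hν : 0 < ν) (hνα : ν < α) :
    Tendsto (fun x : X => |(x : ℝ)| ^ (α - ν) * (∫ z : X, |(z : ℝ)| ^ ν ∂P x - |(x : ℝ)| ^ ν))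
      (atInfinity X) (𝓝 (ν * (c * jumpIntegral α ν + b))) := by
  have h := (hT.tendsto_power_increment hν hνα).add (hD.tendsto_outwardLaw.const_mul ν)
  simp only [sub_add_cancel] at h
  convert! h using 2
  ring

/-- The jump term, of order `r ^ (ν - α)`, is negligible against the drift term, of order `r ^ (ν -
1 - γ)`. -/
lemma OutwardTails.tendsto_power_increment_supercritical (hT : OutwardTails P α β c x₀)
    (hD : DriftAsymptotics P γ b) (hγ : γ < α - 1) {ν : ℝ} (hν : 0 < ν) (hνα : ν < α) :
    Tendsto (fun x : X => |(x : ℝ)| ^ (γ + 1 - ν) *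
      (∫ z : X, |(z : ℝ)| ^ ν ∂P x - |(x : ℝ)| ^ ν)) (atInfinity X) (𝓝 (ν * b)) := by
  have h0 : Tendsto (fun x : X => |(x : ℝ)| ^ (-(α - 1 - γ))) (atInfinity X) (𝓝 0) :=
    (tendsto_rpow_neg_atTop (by linarith)).comp tendsto_abs_atInfinity
  have h := (h0.mul (hT.tendsto_power_increment hν hνα)).add (hD.tendsto_outwardLaw.const_mul ν)
  rw [zero_mul, zero_add] at h
  refine h.congr' ?_
  filter_upwards [tendsto_abs_atInfinity.eventually_gt_atTop 0] with x hx
  have h1 : |(x : ℝ)| ^ (γ + 1 - ν) = |(x : ℝ)| ^ (-(α - 1 - γ)) * |(x : ℝ)| ^ (α - ν) := by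
    rw [← Real.rpow_add hx]; congr 1; ring
  have h2 : |(x : ℝ)| ^ γ = |(x : ℝ)| ^ (-(α - 1 - γ)) * |(x : ℝ)| ^ (α - 1) := by
    rw [← Real.rpow_add hx]; congr 1; ring
  rw [h1, h2]
  ring

lemma OutwardTails.integrable_abs_rpow (hT : OutwardTails P α β c x₀) {ν : ℝ} (hν : 0 < ν)
    (hνα : ν < α) {x : X} (hx : x₀ ≤ |(x : ℝ)|) :
    Integrable (fun z : X => |(z : ℝ)| ^ ν) (P x) := by
  obtain ⟨C, hC, hm⟩ := hT.heavyRightTail.exists_hasTailBound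
  have := hT.heavyRightTail.prob x
  exact (integrable_outwardLaw_comp_iff x (f := fun t => t ^ ν) (by fun_prop)).1
    (hm.integrable_abs_add_rpow hν hνα hC hx _)

/-- If the mean increment of `|x| ^ ν` is of order `-|x| ^ (ν - κ)`, then the passage time has
moments of all orders less than `ν / κ`. -/
lemma OutwardTails.eventually_passageMoment_lt_top (hT : OutwardTails P α β c x₀) {ν κ L q : ℝ}
    (hν : 0 < ν) (hνα : ν < α) (hκ : 0 < κ) (hne : ν / κ ≠ 1) (hL : L < 0)
    (hlim : Tendsto (fun x : X => |(x : ℝ)| ^ (κ - ν) *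
      (∫ z : X, |(z : ℝ)| ^ ν ∂P x - |(x : ℝ)| ^ ν)) (atInfinity X) (𝓝 L))
    (hq : 0 < q) (hqν : q < ν / κ) :
    ∀ᶠ a : ℝ in atTop, ∀ x : X, a < |(x : ℝ)| → passageMoment P a q x < ∞ := by
  have hev : ∀ᶠ x : X in atInfinity X, 0 < |(x : ℝ)| ∧ x₀ ≤ |(x : ℝ)| ∧
      ∫ z : X, |(z : ℝ)| ^ ν ∂P x ≤
        |(x : ℝ)| ^ ν - -L / 2 * (|(x : ℝ)| ^ ν) ^ (1 - 1 / (ν / κ)) := by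
    filter_upwards [tendsto_abs_atInfinity.eventually_gt_atTop 0, eventually_atInfinity_mem x₀,
      hlim.eventually_lt_const (by linarith : L < L / 2)] with x hx hx₀ hlt
    refine ⟨hx, hx₀, ?_⟩
    -- With `f = |x| ^ ν` and `p = ν / κ`, the decrease `f ^ (1 - 1 / p)` of the Lyapunov criteria
    -- is `|x| ^ (ν - κ)`.
    have h1 : (|(x : ℝ)| ^ ν) ^ (1 - 1 / (ν / κ)) = |(x : ℝ)| ^ (-(κ - ν)) := by
      rw [← Real.rpow_mul hx.le]
      congr 1
      field_simp
      ring
    have h2 : 0 < |(x : ℝ)| ^ (κ - ν) := by positivity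
    rw [h1, Real.rpow_neg hx.le]
    have h3 : ∫ z : X, |(z : ℝ)| ^ ν ∂P x - |(x : ℝ)| ^ ν ≤ L / 2 / |(x : ℝ)| ^ (κ - ν) := by
      rw [le_div_iff₀ h2]; linarith
    have h4 : L / 2 / |(x : ℝ)| ^ (κ - ν) = -(-L / 2 * (|(x : ℝ)| ^ (κ - ν))⁻¹) := by
      rw [div_eq_mul_inv]; ring
    linarith
  filter_upwards [eventually_forall_lt_abs hev] with a ha x hx
  have hf : ∀ z : X, 0 ≤ |(z : ℝ)| ^ ν := fun z => by positivity
  have hpos : ∀ x : X, a < |(x : ℝ)| → 0 < |(x : ℝ)| ^ ν := fun x hx =>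
    Real.rpow_pos_of_pos (ha x hx).1 _
  have hint : ∀ x : X, a < |(x : ℝ)| → Integrable (fun z : X => |(z : ℝ)| ^ ν) (P x) :=
    fun x hx => hT.integrable_abs_rpow hν hνα (ha x hx).2.1
  have hε : 0 < -L / 2 := by linarith
  rcases lt_or_gt_of_ne hne with h1 | h1
  · exact passageMoment_lt_top P hq hqν fun n hn =>
      survival_le_of_drift_of_lt_one hf hpos hint hε (by positivity) h1
        (fun x hx => (ha x hx).2.2) hn x
  · exact passageMoment_lt_top P hq hqν fun n hn =>
      survival_le_of_drift_of_one_lt hf hpos hint hε h1 (fun x hx => (ha x hx).2.2) hn x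

lemma OutwardTails.exists_half_le_survival (hT : OutwardTails P α β c x₀)
    (hD : DriftAsymptotics P γ b) (hγ : γ ≤ α - 1) :
    ∃ C : ℝ, 0 < C ∧ ∀ᶠ a : ℝ in atTop, ∀ᶠ n : ℕ in atTop, ∀ x : X,
      2 * (C * n) ^ (1 / (1 + γ)) ≤ |(x : ℝ)| → ∀ k ≤ n, 1 / 2 ≤ survival P a k x := by
  have hγ0 := hD.gamma_nonneg
  have hev : ∀ᶠ x : X in atInfinity X, |∫ θ, θ ∂outwardLaw P x| ≤ (|b| + 1) * |(x : ℝ)| ^ (-γ) := by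
    filter_upwards [tendsto_abs_atInfinity.eventually_gt_atTop 0,
      hD.tendsto_outwardLaw.abs.eventually_lt_const (by linarith : |b| < |b| + 1)] with x hx hlt
    rw [abs_mul, abs_of_pos (Real.rpow_pos_of_pos hx γ)] at hlt
    rw [Real.rpow_neg hx.le, ← div_eq_mul_inv, le_div_iff₀ (by positivity)]
    linarith
  obtain ⟨a₁, ha₁, hx₀⟩ := ((eventually_forall_lt_abs hev).and (eventually_ge_atTop x₀)).exists
  obtain ⟨C, hC, hfar⟩ := exists_le_survival_of_far hT hγ0 hγ (by positivity) hx₀ ha₁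
  -- At the scale `y = (2 C n) ^ (1 / (1 + γ))` the error `n C y ^ (-(1 + γ))` is exactly `1 / 2`.
  refine ⟨2 * C, by positivity, ?_⟩
  filter_upwards [eventually_ge_atTop a₁] with a haa
  have hy : Tendsto (fun n : ℕ => (2 * C * (n : ℝ)) ^ (1 / (1 + γ))) atTop atTop :=
    (tendsto_rpow_atTop (by positivity)).comp
      (tendsto_natCast_atTop_atTop.const_mul_atTop (by positivity))
  filter_upwards [hy.eventually_ge_atTop a, hy.eventually_ge_atTop 1, eventually_ge_atTop 1]
    with n h1 h2 hn x hx k hk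
  have hn0 : (0 : ℝ) < n := by exact_mod_cast hn
  have h3 := hfar a _ haa h1 h2 x hx n
  have h4 : n * (C * ((2 * C * (n : ℝ)) ^ (1 / (1 + γ))) ^ (-(1 + γ))) = 1 / 2 := by
    rw [← Real.rpow_mul (by positivity), show 1 / (1 + γ) * -(1 + γ) = -1 by field_simp,
      Real.rpow_neg_one]
    field_simp
  rw [h4] at h3
  have := antitone_survival P a x hk
  simp only at this
  linarith

/-- The truncated power `min (|x| ^ ν) (T ^ ν)` is a submartingale up to levels comparable to `T`,
when `|x| ^ ν` has mean increments of order `|x| ^ (ν - α)`. -/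
lemma OutwardTails.exists_le_integral_min (hT : OutwardTails P α β c x₀) {ν L : ℝ}
    (hν : 0 < ν) (hνα : ν < α) (hL : 0 < L)
    (hlim : Tendsto (fun x : X => |(x : ℝ)| ^ (α - ν) *
      (∫ z : X, |(z : ℝ)| ^ ν ∂P x - |(x : ℝ)| ^ ν)) (atInfinity X) (𝓝 L)) :
    ∃ N : ℝ, 1 ≤ N ∧ ∀ᶠ a : ℝ in atTop, ∀ x : X, a < |(x : ℝ)| → ∀ R : ℝ, |(x : ℝ)| < R →
      |(x : ℝ)| ^ ν ≤ ∫ z : X, min (|(z : ℝ)| ^ ν) ((N * R) ^ ν) ∂P x := by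
  obtain ⟨C, hC, hm⟩ := hT.heavyRightTail.exists_hasTailBound
  obtain ⟨K, hK0, hK⟩ := hm.exists_lintegral_overshoot_le hν hνα hC
  -- `N` is chosen so large that the mean overshoot lost by truncation at `N * R` is at most half of
  -- the mean gain of `|x| ^ ν`.
  have hN : Tendsto (fun N : ℝ => 2 ^ ν * K * (N / 2) ^ (-(α - ν))) atTop (𝓝 0) := by
    have := ((tendsto_rpow_neg_atTop (by linarith : 0 < α - ν)).comp
      (tendsto_id.atTop_div_const (zero_lt_two' ℝ))).const_mul (2 ^ ν * K)
    rwa [mul_zero] at this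
  obtain ⟨N, hNε, hN2⟩ := ((hN.eventually_lt_const (by linarith : 0 < L / 2)).and
    (eventually_ge_atTop (2 : ℝ))).exists
  refine ⟨N, by linarith, ?_⟩
  have hev : ∀ᶠ x : X in atInfinity X, 0 < |(x : ℝ)| ∧ x₀ ≤ |(x : ℝ)| ∧
      |(x : ℝ)| ^ ν + L / 2 * |(x : ℝ)| ^ (-(α - ν)) ≤ ∫ z : X, |(z : ℝ)| ^ ν ∂P x := by
    filter_upwards [tendsto_abs_atInfinity.eventually_gt_atTop 0, eventually_atInfinity_mem x₀,
      hlim.eventually_const_lt (by linarith : L / 2 < L)] with x hx hx₀ hlt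
    refine ⟨hx, hx₀, ?_⟩
    have h2 : 0 < |(x : ℝ)| ^ (α - ν) := by positivity
    rw [Real.rpow_neg hx.le, ← div_eq_mul_inv]
    have h3 : L / 2 / |(x : ℝ)| ^ (α - ν) ≤ ∫ z : X, |(z : ℝ)| ^ ν ∂P x - |(x : ℝ)| ^ ν := by
      rw [div_le_iff₀ h2]; linarith
    linarith
  filter_upwards [eventually_forall_lt_abs hev] with a ha x hx R hR
  obtain ⟨hx0, hx₀, hinc⟩ := ha x hx
  have := hT.heavyRightTail.prob x
  have hR0 : 0 < R := by linarith
  have hT0 : 0 < N * R := by positivity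
  have hI := hT.integrable_abs_rpow hν hνα hx₀
  have hover : Integrable (fun z : X => max (|(z : ℝ)| ^ ν - (N * R) ^ ν) 0) (P x) :=
    (hI.sub (integrable_const _)).pos_part
  have hsplit : ∫ z : X, min (|(z : ℝ)| ^ ν) ((N * R) ^ ν) ∂P x =
      ∫ z : X, |(z : ℝ)| ^ ν ∂P x - ∫ z : X, max (|(z : ℝ)| ^ ν - (N * R) ^ ν) 0 ∂P x := by
    rw [← integral_sub hI hover]
    congr 1
    ext z
    rcases le_total (|(z : ℝ)| ^ ν) ((N * R) ^ ν) with h | h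
    · rw [min_eq_left h, max_eq_right (by linarith), sub_zero]
    · rw [min_eq_right h, max_eq_left (by linarith)]; ring
  have hloss : ∫ z : X, max (|(z : ℝ)| ^ ν - (N * R) ^ ν) 0 ∂P x ≤
      2 ^ ν * (K * (N * R / 2) ^ (ν - α)) := by
    rw [← integral_outwardLaw_comp (P := P) x (f := fun t => max (t ^ ν - (N * R) ^ ν) 0)
      (by fun_prop), integral_eq_lintegral_of_nonneg_ae
      (f := fun θ => max (|(|(x : ℝ)| + θ)| ^ ν - (N * R) ^ ν) 0) (Eventually.of_forall fun θ => le_max_right _ _)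
      (Measurable.aestronglyMeasurable (by fun_prop))]
    refine ENNReal.toReal_le_of_le_ofReal (by positivity) ?_
    rw [ENNReal.ofReal_mul (by positivity)]
    refine le_trans ?_ (mul_le_mul_right (hK x hx₀ (N * R / 2) (by positivity)) _)
    rw [← lintegral_const_mul _ (by fun_prop)]
    refine lintegral_mono fun θ => ?_
    rw [← ENNReal.ofReal_mul (by positivity), ENNReal.ofReal_max, ENNReal.ofReal_zero, max_le_iff]
    refine ⟨?_, zero_le⟩
    rcases le_total |(|(x : ℝ)| + θ)| (N * R) with h | h
    · rw [ENNReal.ofReal_of_nonpos]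
      · exact zero_le
      · rw [sub_nonpos]
        exact Real.rpow_le_rpow (abs_nonneg _) h hν.le
    · refine ENNReal.ofReal_le_ofReal ?_
      -- Passing `N * R ≥ 2 * R` from within distance `R` requires a jump of size at least `R`,
      -- larger than the starting distance.
      have h1 : |(|(x : ℝ)| + θ)| ≤ 2 * |θ| := by
        have h2 := abs_add_le |(x : ℝ)| θ
        rw [abs_abs] at h2
        nlinarith
      have h2 := Real.rpow_le_rpow (abs_nonneg _) h1 hν.le
      rw [Real.mul_rpow (by norm_num) (abs_nonneg _)] at h2
      rw [mul_sub, Real.div_rpow hT0.le (by norm_num), mul_div_cancel₀ _ (by positivity)]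
      linarith
  have hle : 2 ^ ν * (K * (N * R / 2) ^ (ν - α)) ≤ L / 2 * |(x : ℝ)| ^ (-(α - ν)) := by
    calc 2 ^ ν * (K * (N * R / 2) ^ (ν - α))
        = 2 ^ ν * K * (N / 2) ^ (-(α - ν)) * R ^ (-(α - ν)) := by
          rw [show N * R / 2 = N / 2 * R by ring, Real.mul_rpow (by positivity) hR0.le, neg_sub]
          ring
      _ ≤ L / 2 * R ^ (-(α - ν)) := by gcongr
      _ ≤ L / 2 * |(x : ℝ)| ^ (-(α - ν)) := by
          refine mul_le_mul_of_nonneg_left ?_ (by linarith)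
          exact Real.rpow_le_rpow_of_nonpos hx0 hR.le (by linarith)
  rw [hsplit]
  linarith

/-- If `|x| ^ ν` has mean increments of order `|x| ^ (ν - α)`, then the passage time has no moments
of order `ν / α` or more. -/
lemma OutwardTails.eventually_passageMoment_eq_top (hT : OutwardTails P α β c x₀)
    (hD : DriftAsymptotics P (α - 1) b) {ν L q : ℝ} (hν : 0 < ν) (hνα : ν < α) (hL : 0 < L)
    (hlim : Tendsto (fun x : X => |(x : ℝ)| ^ (α - ν) *
      (∫ z : X, |(z : ℝ)| ^ ν ∂P x - |(x : ℝ)| ^ ν)) (atInfinity X) (𝓝 L))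
    (hq : ν / α ≤ q) :
    ∀ᶠ a : ℝ in atTop, ∀ x : X, a < |(x : ℝ)| → passageMoment P a q x = ∞ := by
  have hα : 0 < α := by linarith
  obtain ⟨C, hC, hfar⟩ := hT.exists_half_le_survival hD le_rfl
  obtain ⟨N, hN1, hN⟩ := hT.exists_le_integral_min hν hνα hL hlim
  filter_upwards [hfar, hN, eventually_ge_atTop x₀, eventually_gt_atTop 0]
    with a hfar hN hax₀ ha0 x hx
  rw [show 1 + (α - 1) = α by ring] at hfar
  have hxν : 0 < |(x : ℝ)| ^ ν - a ^ ν := sub_pos.2 (Real.rpow_lt_rpow ha0.le hx hν)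
  have hR : Tendsto (fun n : ℕ => 2 * (C * (n : ℝ)) ^ (1 / α)) atTop atTop :=
    ((tendsto_rpow_atTop (by positivity)).comp
      (tendsto_natCast_atTop_atTop.const_mul_atTop hC)).const_mul_atTop two_pos
  refine passageMoment_eq_top P (c := 1 / (2 * N ^ ν) * (2 * C ^ (1 / α)) ^ (-ν) *
    (|(x : ℝ)| ^ ν - a ^ ν)) (lt_of_lt_of_le (by positivity) hq) (by positivity) ?_
  filter_upwards [hfar, hR.eventually_gt_atTop |(x : ℝ)|, eventually_ge_atTop 1]
    with n hfar hRn hn1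
  have hn1' : (1 : ℝ) ≤ n := by exact_mod_cast hn1
  have hn0 : (0 : ℝ) < n := by linarith
  set R := 2 * (C * (n : ℝ)) ^ (1 / α) with hRdef
  have hR0 : 0 < R := by positivity
  have hRν : R ^ (-ν) = (2 * C ^ (1 / α)) ^ (-ν) * (n : ℝ) ^ (-(ν / α)) := by
    rw [hRdef, Real.mul_rpow hC.le hn0.le, ← mul_assoc, Real.mul_rpow (by positivity)
      (by positivity), ← Real.rpow_mul hn0.le]
    congr 2
    ring
  -- Subtracting `a ^ ν` makes `G` nonpositive on `[-a, a]`, and the normalisation bounds it by `1 /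
  -- 2`, the survival probability from distance `R`. At the fixed `x` its value is of order `R ^
  -- (-ν)`, that is `n ^ (-ν / α)`.
  have hsub := le_survival_of_submartingale (P := P) (a := a) (ρ := 1 / 2) (R := R) (n := n)
    (G := fun z : X => 1 / (2 * N ^ ν) * R ^ (-ν) *
      (min (|(z : ℝ)| ^ ν) ((N * R) ^ ν) - a ^ ν)) (fun z hz => ?_) (fun z hz => ?_)
    (fun z => ?_) (by norm_num) hfar (fun z hz hzR => ?_) n le_rfl x
  · have hmin : min (|(x : ℝ)| ^ ν) ((N * R) ^ ν) = |(x : ℝ)| ^ ν := by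
      refine min_eq_left (Real.rpow_le_rpow (abs_nonneg _) ?_ hν.le)
      nlinarith
    simp only [hmin] at hsub
    refine le_trans ?_ hsub
    rw [hRν]
    have h1 : (n : ℝ) ^ (-q) ≤ (n : ℝ) ^ (-(ν / α)) :=
      Real.rpow_le_rpow_of_exponent_le hn1' (by linarith)
    calc 1 / (2 * N ^ ν) * (2 * C ^ (1 / α)) ^ (-ν) * (|(x : ℝ)| ^ ν - a ^ ν) * (n : ℝ) ^ (-q)
        ≤ 1 / (2 * N ^ ν) * (2 * C ^ (1 / α)) ^ (-ν) * (|(x : ℝ)| ^ ν - a ^ ν) *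
          (n : ℝ) ^ (-(ν / α)) := by gcongr
      _ = _ := by ring
  · refine mul_nonpos_of_nonneg_of_nonpos (by positivity) (sub_nonpos.2 ?_)
    exact (min_le_left _ _).trans (Real.rpow_le_rpow (abs_nonneg _) hz hν.le)
  · refine Integrable.const_mul (Integrable.sub ?_ (integrable_const _)) _
    exact (hT.integrable_abs_rpow hν hνα (hax₀.trans hz.le)).inf (integrable_const _)
  · have h1 : min (|(z : ℝ)| ^ ν) ((N * R) ^ ν) - a ^ ν ≤ (N * R) ^ ν :=
      (sub_le_self _ (by positivity)).trans (min_le_right _ _)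
    calc 1 / (2 * N ^ ν) * R ^ (-ν) * (min (|(z : ℝ)| ^ ν) ((N * R) ^ ν) - a ^ ν)
        ≤ 1 / (2 * N ^ ν) * R ^ (-ν) * (N * R) ^ ν := by gcongr
      _ = 1 / 2 := by
        rw [Real.mul_rpow (by linarith) hR0.le, Real.rpow_neg hR0.le]
        field_simp
  · have hmin : min (|(z : ℝ)| ^ ν) ((N * R) ^ ν) = |(z : ℝ)| ^ ν := by
      refine min_eq_left (Real.rpow_le_rpow (abs_nonneg _) ?_ hν.le)
      nlinarith
    have hint : Integrable (fun w : X => min (|(w : ℝ)| ^ ν) ((N * R) ^ ν)) (P z) :=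
      (hT.integrable_abs_rpow hν hνα (hax₀.trans hz.le)).inf (integrable_const _)
    simp only [hmin]
    rw [integral_const_mul, integral_sub hint (integrable_const _)]
    simp only [integral_const, probReal_univ, one_smul]
    have := hN z hz R hzR
    gcongr

/-- One big jump followed by a long return time gives the lower bound on the survival
probability. -/
lemma OutwardTails.eventually_passageMoment_eq_top_of_jump (hT : OutwardTails P α β c x₀)
    (hD : DriftAsymptotics P γ b) (hγ : γ ≤ α - 1) {q : ℝ} (hq : α / (γ + 1) ≤ q) :
    ∀ᶠ a : ℝ in atTop, ∀ x : X, a < |(x : ℝ)| → passageMoment P a q x = ∞ := by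
  have hγ0 := hD.gamma_nonneg
  have hα := hT.one_lt_alpha
  have hc := hT.c_pos
  obtain ⟨C, hC, hfar⟩ := hT.exists_half_le_survival hD hγ
  filter_upwards [hfar, eventually_ge_atTop x₀] with a hfar hax₀ x hx
  have hxS : x ∈ {x : X | x₀ ≤ |(x : ℝ)|} := show x₀ ≤ |(x : ℝ)| by linarith
  have hR : Tendsto (fun n : ℕ => 2 * (C * (n : ℝ)) ^ (1 / (1 + γ))) atTop atTop :=
    ((tendsto_rpow_atTop (by positivity)).comp
      (tendsto_natCast_atTop_atTop.const_mul_atTop hC)).const_mul_atTop two_pos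
  have htail := hR.eventually
    (Metric.tendstoUniformlyOn_iff.1 hT.heavyRightTail.right (c / 2) (by linarith))
  refine passageMoment_eq_top P (c := 1 / 2 * (c / 2 * (2 * C ^ (1 / (1 + γ))) ^ (-α)))
    (lt_of_lt_of_le (by positivity) hq) (by positivity) ?_
  have key : ∀ᶠ n : ℕ in atTop, 1 / 2 * (c / 2 * (2 * C ^ (1 / (1 + γ))) ^ (-α)) *
      ((n + 1 : ℕ) : ℝ) ^ (-q) ≤ survival P a (n + 1) x := by
    filter_upwards [hfar, htail, eventually_ge_atTop 1] with n hfar htail hn1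
    have hn1' : (1 : ℝ) ≤ n := by exact_mod_cast hn1
    have hn0 : (0 : ℝ) < n := by linarith
    set R := 2 * (C * (n : ℝ)) ^ (1 / (1 + γ)) with hRdef
    have hR0 : 0 < R := by positivity
    have hRα : R ^ (-α) = (2 * C ^ (1 / (1 + γ))) ^ (-α) * (n : ℝ) ^ (-(α / (γ + 1))) := by
      rw [hRdef, Real.mul_rpow hC.le hn0.le, ← mul_assoc, Real.mul_rpow (by positivity)
        (by positivity), ← Real.rpow_mul hn0.le]
      congr 2
      rw [add_comm γ 1]
      ring
    -- An outward jump of more than `R` lands beyond `R` whatever the starting point; for large `n`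
    -- the tail is at least half its asymptotic value.
    have hjump : c / 2 * R ^ (-α) ≤ (P x).real {z : X | R ≤ |(z : ℝ)|} := by
      have h1 := htail x hxS
      rw [Real.dist_eq] at h1
      have h2 := (abs_lt.1 h1).2
      have h3 : (outwardLaw P x).real (Ioi R) ≤ (P x).real {z : X | R ≤ |(z : ℝ)|} := by
        rw [outwardLaw, map_measureReal_apply (measurable_outward x) measurableSet_Ioi]
        refine measureReal_mono fun z hz => ?_
        have hz' : R < outward x z := hz
        change R ≤ |(z : ℝ)|
        rw [← abs_abs_add_outward x z]
        refine le_trans ?_ (le_abs_self _)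
        have := abs_nonneg (x : ℝ)
        linarith
      refine le_trans ?_ h3
      rw [Real.rpow_neg hR0.le, ← div_eq_mul_inv, div_le_iff₀ (by positivity)]
      linarith
    have hmeas : MeasurableSet {z : X | R ≤ |(z : ℝ)|} :=
      measurableSet_le measurable_const measurable_subtype_coe.abs
    have hsurv : 1 / 2 * (P x).real {z : X | R ≤ |(z : ℝ)|} ≤ survival P a (n + 1) x := by
      rw [survival_succ P n hx, mul_comm, ← smul_eq_mul, ← integral_indicator_const _ hmeas]
      refine integral_mono ((integrable_const _).indicator hmeas) (integrable_survival P a n x)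
        fun z => ?_
      by_cases hz : R ≤ |(z : ℝ)|
      · rw [indicator_of_mem (show z ∈ {z : X | R ≤ |(z : ℝ)|} from hz)]
        exact hfar z hz n le_rfl
      · rw [indicator_of_notMem (show z ∉ {z : X | R ≤ |(z : ℝ)|} from hz)]
        exact survival_nonneg P a n z
    have h1 : ((n + 1 : ℕ) : ℝ) ^ (-q) ≤ (n : ℝ) ^ (-(α / (γ + 1))) := by
      calc ((n + 1 : ℕ) : ℝ) ^ (-q) ≤ (n : ℝ) ^ (-q) := by
            refine Real.rpow_le_rpow_of_nonpos hn0 (by push_cast; linarith) ?_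
            have : 0 < α / (γ + 1) := by positivity
            linarith
        _ ≤ _ := Real.rpow_le_rpow_of_exponent_le hn1' (by linarith)
    calc 1 / 2 * (c / 2 * (2 * C ^ (1 / (1 + γ))) ^ (-α)) * ((n + 1 : ℕ) : ℝ) ^ (-q)
        ≤ 1 / 2 * (c / 2 * (2 * C ^ (1 / (1 + γ))) ^ (-α)) * (n : ℝ) ^ (-(α / (γ + 1))) := by
          gcongr
      _ = 1 / 2 * (c / 2 * R ^ (-α)) := by rw [hRα]; ring
      _ ≤ 1 / 2 * (P x).real {z : X | R ≤ |(z : ℝ)|} := by gcongr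
      _ ≤ _ := hsurv
  obtain ⟨n₀, hn₀⟩ := eventually_atTop.1 key
  filter_upwards [eventually_ge_atTop (n₀ + 1)] with n hn
  obtain ⟨k, rfl⟩ : ∃ k, n = k + 1 := ⟨n - 1, by omega⟩
  exact hn₀ k (by omega)

/-- The phase transition for the moments of the passage time in the critical case, where the drift
is of order `|x| ^ (1 - α)`. -/
lemma OutwardTails.eventually_passageMoment_critical (hT : OutwardTails P α β c x₀)
    (hD : DriftAsymptotics P (α - 1) b) {ν : ℝ} (hν : IsCriticalExponent α b c ν) {q : ℝ}
    (hq : 0 < q) :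
    ∀ᶠ a : ℝ in atTop, ∀ x : X, a < |(x : ℝ)| →
      (q < ν / α → passageMoment P a q x < ∞) ∧ (ν / α < q → passageMoment P a q x = ∞) := by
  have hα1 := hT.one_lt_alpha
  have hα2 := hT.alpha_lt_two
  have hc := hT.c_pos
  have hα : 0 < α := by linarith
  obtain ⟨⟨hν0, hνα⟩, heq⟩ := (isCriticalExponent_iff hα1 hα2).1 hν
  have hb : b = -(c * jumpIntegral α ν) := by
    rw [div_eq_iff hc.ne'] at heq; rw [heq]; ring
  rcases lt_trichotomy q (ν / α) with h | h | h
  · rw [lt_div_iff₀ hα] at h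
    -- Any exponent between `q α` and the critical one gives a supermartingale and still exceeds the
    -- order `q`.
    obtain ⟨ν', hν'1, hν'2⟩ := exists_between h
    have hν'0 : 0 < ν' := lt_trans (by positivity) hν'1
    have hJ := jumpIntegral_lt hα1 hα2 hν'0 hν'2 hνα
    have hlim := hT.tendsto_power_increment_critical hD hν'0 (hν'2.trans hνα)
    have hq' : q < ν' / α := (lt_div_iff₀ hα).2 hν'1
    have hlt : ν' / α < 1 := (div_lt_one hα).2 (hν'2.trans hνα)
    filter_upwards [hT.eventually_passageMoment_lt_top hν'0 (hν'2.trans hνα) hα hlt.ne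
      (mul_neg_of_pos_of_neg hν'0 (by rw [hb]; nlinarith)) hlim hq hq'] with a ha x hx
    refine ⟨fun _ => ha x hx, fun h' => ?_⟩
    rw [div_lt_iff₀ hα] at h'
    linarith
  · exact Eventually.of_forall fun a x _ => ⟨fun h' => absurd h h'.ne, fun h' => absurd h h'.ne'⟩
  · have h2 : ν < min α (q * α) := lt_min hνα ((div_lt_iff₀ hα).1 h)
    obtain ⟨ν', hν'1, hν'2⟩ := exists_between h2
    have hν'0 : 0 < ν' := hν0.trans hν'1
    have hν'α : ν' < α := hν'2.trans_le (min_le_left _ _)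
    have hJ := jumpIntegral_lt hα1 hα2 hν0 hν'1 hν'α
    have hlim := hT.tendsto_power_increment_critical hD hν'0 hν'α
    have hq' : ν' / α ≤ q := (div_le_iff₀ hα).2 (hν'2.le.trans (min_le_right _ _))
    filter_upwards [hT.eventually_passageMoment_eq_top hD hν'0 hν'α
      (mul_pos hν'0 (by rw [hb]; nlinarith)) hlim hq'] with a ha x hx
    exact ⟨fun h' => absurd h h'.not_gt, fun _ => ha x hx⟩

/-- The phase transition for the moments of the passage time when an inward drift dominates the
heavy outward tail. -/
lemma OutwardTails.eventually_passageMoment_supercritical (hT : OutwardTails P α β c x₀)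
    (hD : DriftAsymptotics P γ b) (hγ : γ < α - 1) (hb : b < 0) {q : ℝ} (hq : 0 < q) :
    ∀ᶠ a : ℝ in atTop, ∀ x : X, a < |(x : ℝ)| →
      (q < α / (γ + 1) → passageMoment P a q x < ∞) ∧
      (α / (γ + 1) ≤ q → passageMoment P a q x = ∞) := by
  have hγ0 := hD.gamma_nonneg
  have hγ1 : 0 < γ + 1 := by linarith
  rcases lt_or_ge q (α / (γ + 1)) with h | h
  -- Taking `ν > γ + 1`, possible since `γ < α - 1`, puts the Lyapunov bound in the range `p > 1`
  -- whatever `q` is.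
  · have h2 : max (q * (γ + 1)) (γ + 1) < α := max_lt ((lt_div_iff₀ hγ1).1 h) (by linarith)
    obtain ⟨ν, hν1, hνα⟩ := exists_between h2
    have hν0 : 0 < ν := lt_trans (lt_max_of_lt_right hγ1) hν1
    have hgt : 1 < ν / (γ + 1) := (one_lt_div hγ1).2 ((le_max_right _ _).trans_lt hν1)
    have hq' : q < ν / (γ + 1) := (lt_div_iff₀ hγ1).2 ((le_max_left _ _).trans_lt hν1)
    filter_upwards [hT.eventually_passageMoment_lt_top hν0 hνα hγ1 hgt.ne'
      (mul_neg_of_pos_of_neg hν0 hb) (hT.tendsto_power_increment_supercritical hD hγ hν0 hνα)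
      hq hq'] with a ha x hx
    exact ⟨fun _ => ha x hx, fun h' => absurd h h'.not_gt⟩
  · filter_upwards [hT.eventually_passageMoment_eq_top_of_jump hD hγ.le h] with a ha x hx
    exact ⟨fun h' => absurd h h'.not_ge, fun _ => ha x hx⟩

end PassageMoments

end

end HeavyTailedWalk

/-! ### The three drift regimes -/

theorem theorem2p4 (X : Set ℝ) (hX : MeasurableSet X) (hX' : ¬ Bornology.IsBounded X)
    (P : Kernel X X) [IsMarkovKernel P] (α β c x₀ γ b : ℝ)
    (hT : HeavyTailedWalk.OutwardTails P α β c x₀)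
    (hD : HeavyTailedWalk.DriftAsymptotics P γ b) :
    (α - 1 < γ →
      ∀ q : ℝ, 0 < q → ∀ᶠ a : ℝ in atTop, ∀ x : X, a < |(x : ℝ)| →
        (q < 1 / α → HeavyTailedWalk.passageMoment P a q x < ∞) ∧
        (1 / α < q → HeavyTailedWalk.passageMoment P a q x = ∞)) ∧
    (γ = α - 1 → b < c * Real.pi * |1 / Real.sin (Real.pi * α)| →
      (∃! ν : ℝ, HeavyTailedWalk.IsCriticalExponent α b c ν) ∧
      ∀ ν : ℝ, HeavyTailedWalk.IsCriticalExponent α b c ν →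
        ∀ q : ℝ, 0 < q → ∀ᶠ a : ℝ in atTop, ∀ x : X, a < |(x : ℝ)| →
          (q < ν / α → HeavyTailedWalk.passageMoment P a q x < ∞) ∧
          (ν / α < q → HeavyTailedWalk.passageMoment P a q x = ∞)) ∧
    (γ < α - 1 → b < 0 →
      ∀ q : ℝ, 0 < q → ∀ᶠ a : ℝ in atTop, ∀ x : X, a < |(x : ℝ)| →
        (q < α / (γ + 1) → HeavyTailedWalk.passageMoment P a q x < ∞) ∧
        (α / (γ + 1) ≤ q → HeavyTailedWalk.passageMoment P a q x = ∞)) := by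
  have hα1 := hT.one_lt_alpha
  have hα2 := hT.alpha_lt_two
  have hc := hT.c_pos
  refine ⟨fun hγ q hq => ?_, fun hγ hb => ⟨?_, fun ν hν q hq => ?_⟩, fun hγ hb q hq => ?_⟩
  -- A drift of smaller order than `r ^ (1 - α)` is the critical case with `b = 0`, where the
  -- exponent is `1`.
  · exact hT.eventually_passageMoment_critical (hD.of_lt (by linarith) hγ)
      (HeavyTailedWalk.isCriticalExponent_zero_one hα1) hq
  · exact HeavyTailedWalk.existsUnique_isCriticalExponent hα1 hα2 hc hb
  · subst hγ
    exact hT.eventually_passageMoment_critical hD hν hq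
  · exact hT.eventually_passageMoment_supercritical hD hγ hb hq
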